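/- **Theorem 3.3.** Let $G$ be a locally compact, Hausdorff, étale groupoid with unit space $G^{(0)}$, source map $s$ and range map $r$ (étale means that $G$ is a topological groupoid whose source map $s\colon G\to G^{(0)}$ is a local homeomorphism). Suppose that $G$ is minimal, i.e. $\{r(\gamma) : s(\gamma)=u\}$ is dense in $G^{(0)}$ for every $u\in G^{(0)}$, and topologically principal, i.e. the set of $u\in G^{(0)}$ for which the only $\gamma\in G$ with $r(\gamma)=s(\gamma)=u$ is $u$ itself is dense in $G^{(0)}$. Then $C^*_r(G)$ is purely infinite if and only if every nonzero positive element of $C_0(G^{(0)})$ is infinite in $C^*_r(G)$. Here $C^*_r(G)$ is the completion of the convolution $*$-algebra $C_c(G)$ in the norm $\|f\|_r=\sup_{u\in G^{(0)}}\|\pi_u(f)\|$, where $\pi_u$ is the regular representation on $\ell^2(\{\gamma : s(\gamma)=u\})$ given by $\pi_u(f)\delta_\gamma=\sum_{s(\eta)=r(\gamma)}f(\eta)\delta_{\eta\gamma}$, and $C_0(G^{(0)})\subseteq C^*_r(G)$ via the embedding extending each function by zero off $G^{(0)}$. For positive matrices $a\in M_n(A)$, $b\in M_m(A)$ over a $C^*$-algebra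 $A$, write $a\precsim b$ if there are $x_k\in M_{m,n}(A)$ with $x_k^*bx_k\to a$ in norm. A positive element $a\in A$ is infinite if $a\oplus b\precsim a$ for some nonzero positive $b\in A$. The algebra $A$ is purely infinite if it has no characters and, for all positive $a,b\in A$, one has $a\precsim b$ if and only if $a$ belongs to the closed two-sided ideal $\overline{AbA}$ generated by $b$. -/

import Mathlib

open CategoryTheory Filter Topology
open scoped ENNReal NNReal ComplexOrder lp CompactlySupported ZeroAtInfty

noncomputable section

namespace GroupoidCStar

/-! ### Operators on `ℓ²` given by a kernel -/

section Kernel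

variable {ι : Type*}

/-- The row sums and the column sums of `‖K‖` are at most `M`. -/
def KernelBound (K : ι → ι → ℂ) (M : ℝ≥0) : Prop :=
  (∀ i, ∑' j, ‖K i j‖ₑ ≤ M) ∧ ∀ j, ∑' i, ‖K i j‖ₑ ≤ M

lemma two_mul_mul_le (a b : ℝ≥0∞) : 2 * (a * b) ≤ a ^ 2 + b ^ 2 := by
  by_cases ha : a = ∞
  · simp [ha]
  by_cases hb : b = ∞
  · simp [hb]
  lift a to ℝ≥0 using ha
  lift b to ℝ≥0 using hb
  have := two_mul_le_add_sq a b
  rw [← mul_assoc]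
  exact_mod_cast this

lemma sq_tsum_mul_le (k x : ι → ℝ≥0∞) :
    (∑' j, k j * x j) ^ 2 ≤ (∑' j, k j) * ∑' j, k j * x j ^ 2 := by
  have h1 : (∑' j, k j * x j) ^ 2 = ∑' j, ∑' l, (k j * k l) * (x j * x l) := by
    rw [sq, ← ENNReal.tsum_mul_right]
    refine tsum_congr fun j => ?_
    rw [← ENNReal.tsum_mul_left]
    exact tsum_congr fun l => by ring
  have h2 : (∑' j, k j) * ∑' j, k j * x j ^ 2 = ∑' j, ∑' l, (k j * k l) * x l ^ 2 := by
    rw [← ENNReal.tsum_mul_right]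
    refine tsum_congr fun j => ?_
    rw [← ENNReal.tsum_mul_left]
    exact tsum_congr fun l => by ring
  have h3 : (∑' j, k j) * ∑' j, k j * x j ^ 2 = ∑' j, ∑' l, (k j * k l) * x j ^ 2 := by
    rw [h2, ENNReal.tsum_comm]
    exact tsum_congr fun j => tsum_congr fun l => by ring
  have h4 : 2 * (∑' j, k j * x j) ^ 2 ≤ 2 * ((∑' j, k j) * ∑' j, k j * x j ^ 2) := by
    rw [two_mul (_ * _), h1]
    nth_rw 1 [h3]
    rw [h2, ← ENNReal.tsum_add, ← ENNReal.tsum_mul_left]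
    refine ENNReal.tsum_le_tsum fun j => ?_
    rw [← ENNReal.tsum_add, ← ENNReal.tsum_mul_left]
    refine ENNReal.tsum_le_tsum fun l => ?_
    calc 2 * (k j * k l * (x j * x l)) = (k j * k l) * (2 * (x j * x l)) := by ring
      _ ≤ (k j * k l) * (x j ^ 2 + x l ^ 2) := by gcongr; exact two_mul_mul_le _ _
      _ = _ := by ring
  exact (ENNReal.mul_le_mul_iff_right (by norm_num) (by norm_num)).1 h4

lemma tsum_enorm_sq (ξ : ℓ²(ι, ℂ)) : ∑' i, ‖ξ i‖ₑ ^ 2 = ENNReal.ofReal (‖ξ‖ ^ 2) := by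
  have h := lp.hasSum_norm (p := 2) (by norm_num) ξ
  norm_num at h
  rw [← h.tsum_eq, ENNReal.ofReal_tsum_of_nonneg (fun _ => by positivity) h.summable]
  refine tsum_congr fun i => ?_
  rw [ENNReal.ofReal_pow (norm_nonneg _), ofReal_norm]

lemma KernelBound.summable {K : ι → ι → ℂ} {M : ℝ≥0} (hK : KernelBound K M)
    (ξ : ℓ²(ι, ℂ)) (i : ι) : Summable fun j => K i j * ξ j := by
  have h1 : Summable fun j => ‖K i j‖ := by
    rw [← tsum_enorm_ne_top_iff_summable_norm]
    exact ne_top_of_le_ne_top ENNReal.coe_ne_top (hK.1 i)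
  refine Summable.of_norm_bounded (h1.mul_right ‖ξ‖) fun j => ?_
  rw [norm_mul]
  gcongr
  exact lp.norm_apply_le_norm (by norm_num) ξ j

lemma KernelBound.tsum_le {K : ι → ι → ℂ} {M : ℝ≥0} (hK : KernelBound K M) (ξ : ℓ²(ι, ℂ)) :
    ∑' i, ‖∑' j, K i j * ξ j‖ₑ ^ 2 ≤ ENNReal.ofReal ((M * ‖ξ‖) ^ 2) := by
  calc ∑' i, ‖∑' j, K i j * ξ j‖ₑ ^ 2
      ≤ ∑' i, (∑' j, ‖K i j‖ₑ * ‖ξ j‖ₑ) ^ 2 := by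
        refine ENNReal.tsum_le_tsum fun i => ?_
        gcongr
        refine enorm_tsum_le_tsum_enorm.trans_eq ?_
        exact tsum_congr fun j => enorm_mul _ _
    _ ≤ ∑' i, M * ∑' j, ‖K i j‖ₑ * ‖ξ j‖ₑ ^ 2 := by
        refine ENNReal.tsum_le_tsum fun i => (sq_tsum_mul_le _ _).trans ?_
        gcongr
        exact hK.1 i
    _ = M * ∑' j, (∑' i, ‖K i j‖ₑ) * ‖ξ j‖ₑ ^ 2 := by
        rw [ENNReal.tsum_mul_left, ENNReal.tsum_comm]
        simp_rw [ENNReal.tsum_mul_right]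
    _ ≤ M * ∑' j, M * ‖ξ j‖ₑ ^ 2 := by
        gcongr with j
        exact hK.2 j
    _ = ENNReal.ofReal ((M * ‖ξ‖) ^ 2) := by
        rw [ENNReal.tsum_mul_left, tsum_enorm_sq, mul_pow, ENNReal.ofReal_mul (by positivity),
          ENNReal.ofReal_pow (by positivity), ENNReal.ofReal_pow (by positivity),
          ENNReal.ofReal_coe_nnreal]
        ring

/-- The bounded operator on `ℓ²(ι)` with matrix `K`: `(T ξ) i = ∑ j, K i j * ξ j`. -/
def kernelOp (K : ι → ι → ℂ) (M : ℝ≥0) (hK : KernelBound K M) : ℓ²(ι, ℂ) →L[ℂ] ℓ²(ι, ℂ) :=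
  LinearMap.mkContinuous
    { toFun := fun ξ => ⟨fun i => ∑' j, K i j * ξ j, by
        apply memℓp_gen
        have h : ∑' i, ‖∑' j, K i j * ξ j‖ₑ ^ 2 ≠ ∞ :=
          ne_top_of_le_ne_top ENNReal.ofReal_ne_top (hK.tsum_le ξ)
        have h2 : Summable fun i => ‖(∑' j, K i j * ξ j) ^ 2‖ := by
          rw [← tsum_enorm_ne_top_iff_summable_norm]
          simpa [enorm_pow] using h
        simpa [norm_pow] using h2⟩
      map_add' := fun ξ η => by
        ext i
        simp only [lp.coeFn_add, Pi.add_apply, mul_add]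
        exact (hK.summable ξ i).tsum_add (hK.summable η i)
      map_smul' := fun c ξ => by
        ext i
        simp only [lp.coeFn_smul, Pi.smul_apply, smul_eq_mul, RingHom.id_apply]
        rw [← tsum_mul_left]
        exact tsum_congr fun j => by ring }
    M fun ξ => by
      rw [← sq_le_sq₀ (norm_nonneg _) (by positivity), ← ENNReal.ofReal_le_ofReal_iff (by positivity),
        ← tsum_enorm_sq]
      exact hK.tsum_le ξ

lemma kernelOp_apply {K : ι → ι → ℂ} {M : ℝ≥0} (hK : KernelBound K M) (ξ : ℓ²(ι, ℂ)) (i : ι) :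
    kernelOp K M hK ξ i = ∑' j, K i j * ξ j := rfl

lemma norm_kernelOp_le {K : ι → ι → ℂ} {M : ℝ≥0} (hK : KernelBound K M) :
    ‖kernelOp K M hK‖ ≤ M :=
  LinearMap.mkContinuous_norm_le _ M.2 _

lemma kernelOp_single [DecidableEq ι] {K : ι → ι → ℂ} {M : ℝ≥0} (hK : KernelBound K M) (i j : ι) :
    kernelOp K M hK (lp.single 2 j 1) i = K i j := by
  rw [kernelOp_apply, tsum_eq_single j]
  · simp
  · intro l hl
    simp [lp.single_apply, hl]

/-- Operators on `ℓ²(ι)` are determined by their matrices. -/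
lemma ext_matrix [DecidableEq ι] {S T : ℓ²(ι, ℂ) →L[ℂ] ℓ²(ι, ℂ)}
    (h : ∀ i j, S (lp.single 2 j 1) i = T (lp.single 2 j 1) i) : S = T := by
  refine lp.ext_continuousLinearMap (by norm_num) fun j => ?_
  ext : 1
  ext i
  exact h i j

lemma kernelOp_mul {K L N : ι → ι → ℂ} {M M' M'' : ℝ≥0} (hK : KernelBound K M)
    (hL : KernelBound L M') (hN : KernelBound N M'')
    (h : ∀ i j, N i j = ∑' l, K i l * L l j) :
    kernelOp N M'' hN = kernelOp K M hK * kernelOp L M' hL := by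
  classical
  refine ext_matrix fun i j => ?_
  rw [kernelOp_single, h, mul_apply_eq_comp, kernelOp_apply]
  exact tsum_congr fun l => by rw [kernelOp_single]

lemma kernelOp_star {K L : ι → ι → ℂ} {M M' : ℝ≥0} (hK : KernelBound K M)
    (hL : KernelBound L M') (h : ∀ i j, L i j = star (K j i)) :
    kernelOp L M' hL = star (kernelOp K M hK) := by
  classical
  refine ext_matrix fun i j => ?_
  rw [kernelOp_single, h, ContinuousLinearMap.star_eq_adjoint]
  have h1 := lp.inner_single_left (𝕜 := ℂ) (G := fun _ : ι => ℂ) i 1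
    ((kernelOp K M hK).adjoint (lp.single 2 j 1))
  rw [ContinuousLinearMap.adjoint_inner_right, lp.inner_single_right, kernelOp_single] at h1
  simpa using h1

end Kernel

/-! ### Topological groupoids -/

section Groupoid

/-- The bounded families `(a_i)` with `a_i ∈ B i` form a C*-algebra for the supremum norm. -/
@[reducible]
def linftyNonUnitalCStarAlgebra {I : Type*} (B : I → Type*) [∀ i, NonUnitalCStarAlgebra (B i)] :
    NonUnitalCStarAlgebra (lp B ∞) where
  __ := (inferInstance : NonUnitalNormedRing (lp B ∞))
  __ := (inferInstance : StarRing (lp B ∞))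
  __ := (inferInstance : CompleteSpace (lp B ∞))
  __ := (inferInstance : CStarRing (lp B ∞))
  __ := (inferInstance : NormedSpace ℂ (lp B ∞))
  __ := (inferInstance : StarModule ℂ (lp B ∞))
  smul_assoc := fun c f g => Subtype.ext (funext fun i => smul_assoc c (f.1 i) (g.1 i))
  smul_comm := fun c f g => Subtype.ext (funext fun i => smul_comm c (f.1 i) (g.1 i))

variable (X : Type*) [Groupoid X]

/-- Pairs of morphisms `x ⟶ y`, `y ⟶ z`. -/
def ComposablePairs : Type _ := {p : Arrow X × Arrow X // p.1.right = p.2.left}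

instance [TopologicalSpace (Arrow X)] : TopologicalSpace (ComposablePairs X) :=
  inferInstanceAs (TopologicalSpace {p : Arrow X × Arrow X // p.1.right = p.2.left})

variable {X}

/-- The identity morphism at `x`, as an element of the set of all morphisms. -/
def idArrow (x : X) : Arrow X := Arrow.mk (𝟙 x)

/-- The inverse of a morphism. -/
def invArrow (γ : Arrow X) : Arrow X := Arrow.mk (inv γ.hom)

/-- The composition of a composable pair. -/
def compArrow (p : ComposablePairs X) : Arrow X :=
  Arrow.mk (p.1.1.hom ≫ eqToHom p.2 ≫ p.1.2.hom)

lemma compArrow_mk {x y z : X} (f : x ⟶ y) (g : y ⟶ z)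
    (h : (Arrow.mk f, Arrow.mk g).1.right = (Arrow.mk f, Arrow.mk g).2.left) :
    compArrow ⟨(Arrow.mk f, Arrow.mk g), h⟩ = Arrow.mk (f ≫ g) := by
  simp [compArrow]

variable (X) in
/-- A topological groupoid: the set `G = Arrow X` of morphisms carries a topology for which
composition and inversion are continuous. The set of objects `X` is identified with the set of
identity morphisms and carries the subspace topology. -/
class IsTopologicalGroupoid [TopologicalSpace X] [TopologicalSpace (Arrow X)] : Prop where
  isInducing_idArrow : IsInducing (idArrow : X → Arrow X)
  continuous_compArrow : Continuous (compArrow : ComposablePairs X → Arrow X)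
  continuous_invArrow : Continuous (invArrow : Arrow X → Arrow X)

variable (X) in
/-- An étale groupoid: a topological groupoid whose source map is a local homeomorphism. -/
class IsEtaleGroupoid [TopologicalSpace X] [TopologicalSpace (Arrow X)] : Prop
    extends IsTopologicalGroupoid X where
  isLocalHomeomorph_source : IsLocalHomeomorph (fun γ : Arrow X => γ.left)

variable (X) in
/-- The set of units with trivial isotropy group is dense in the unit space. -/
def IsTopologicallyPrincipal [TopologicalSpace X] : Prop :=
  Dense {x : X | ∀ γ : x ⟶ x, γ = 𝟙 x}

variable (X) in
/-- Every orbit `{r(γ) : s(γ) = x}` is dense in the unit space. -/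
def IsMinimalGroupoid [TopologicalSpace X] : Prop :=
  ∀ x : X, Dense {y : X | ∃ γ : Arrow X, γ.left = x ∧ γ.right = y}

/-- `G u`, the set of morphisms with source `u`. -/
abbrev SourceFiber (u : X) : Type _ := Σ y : X, (u ⟶ y)

/-- `u G`, the set of morphisms with range `u`. -/
abbrev RangeFiber (u : X) : Type _ := Σ z : X, (z ⟶ u)

/-- The norm `‖F‖_I = sup_u max (∑_{γ ∈ G u} |F γ|) (∑_{γ ∈ u G} |F γ|)`. -/
def iNorm (F : Arrow X → ℂ) : ℝ≥0∞ :=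
  ⨆ u : X, max (∑' γ : SourceFiber u, ‖F (Arrow.mk γ.2)‖ₑ)
    (∑' γ : RangeFiber u, ‖F (Arrow.mk γ.2)‖ₑ)

/-- The matrix of the regular representation on `ℓ²(G u)`: the `(γ, η)` entry is `F(γ η⁻¹)`. -/
def regKernel (F : Arrow X → ℂ) (u : X) (γ η : SourceFiber u) : ℂ :=
  F (Arrow.mk (inv η.2 ≫ γ.2))

/-- For `γ ∈ G u`, the bijection `η ↦ γ η⁻¹` from `G u` onto `r(γ) G`. -/
def rangeEquiv {u : X} (γ : SourceFiber u) : SourceFiber u ≃ RangeFiber γ.1 where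
  toFun η := ⟨η.1, inv η.2 ≫ γ.2⟩
  invFun ζ := ⟨ζ.1, γ.2 ≫ inv ζ.2⟩
  left_inv η := by simp
  right_inv ζ := by simp

/-- For `η ∈ G u`, the bijection `γ ↦ γ η⁻¹` from `G u` onto `G r(η)`. -/
def sourceEquiv {u : X} (η : SourceFiber u) : SourceFiber u ≃ SourceFiber η.1 where
  toFun γ := ⟨γ.1, inv η.2 ≫ γ.2⟩
  invFun ζ := ⟨ζ.1, η.2 ≫ ζ.2⟩
  left_inv γ := by simp
  right_inv ζ := by simp

lemma kernelBound_regKernel {F : Arrow X → ℂ} (hF : iNorm F ≠ ∞) (u : X) :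
    KernelBound (regKernel F u) (iNorm F).toNNReal := by
  rw [KernelBound, ENNReal.coe_toNNReal hF]
  constructor
  · intro γ
    refine le_trans (le_of_eq ?_) ((le_max_right _ _).trans (le_iSup (fun u : X => max (∑' γ : SourceFiber u, ‖F (Arrow.mk γ.2)‖ₑ)
      (∑' γ : RangeFiber u, ‖F (Arrow.mk γ.2)‖ₑ)) γ.1))
    exact (rangeEquiv γ).tsum_eq (fun ζ => ‖F (Arrow.mk ζ.2)‖ₑ)
  · intro η
    refine le_trans (le_of_eq ?_) ((le_max_left _ _).trans (le_iSup (fun u : X => max (∑' γ : SourceFiber u, ‖F (Arrow.mk γ.2)‖ₑ)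
      (∑' γ : RangeFiber u, ‖F (Arrow.mk γ.2)‖ₑ)) η.1))
    exact (sourceEquiv η).tsum_eq (fun ζ => ‖F (Arrow.mk ζ.2)‖ₑ)

/-- The regular representation `π_u` on `ℓ²(G u)`, characterized by
`π_u(F) δ_η = ∑_{s(ζ) = r(η)} F(ζ) δ_{ζ η}`, that is,
`(π_u(F) ξ)(γ) = ∑_{η ∈ G u} F(γ η⁻¹) ξ(η)`. -/
def regRepAt (F : Arrow X → ℂ) (hF : iNorm F ≠ ∞) (u : X) :
    ℓ²(SourceFiber u, ℂ) →L[ℂ] ℓ²(SourceFiber u, ℂ) :=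
  kernelOp (regKernel F u) _ (kernelBound_regKernel hF u)

variable (X) in
/-- Bounded families of operators on the spaces `ℓ²(G u)`, with the supremum norm. -/
def RegOps : Type _ :=
  lp (fun u : X => ℓ²(SourceFiber u, ℂ) →L[ℂ] ℓ²(SourceFiber u, ℂ)) ∞

instance : NonUnitalCStarAlgebra (RegOps X) :=
  linftyNonUnitalCStarAlgebra fun u : X => ℓ²(SourceFiber u, ℂ) →L[ℂ] ℓ²(SourceFiber u, ℂ)

lemma RegOps.ext {S T : RegOps X} (h : ∀ u, S.1 u = T.1 u) : S = T := lp.ext (funext h)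

/-- The family `(π_u(F))_u`. Its norm is `sup_u ‖π_u(F)‖`. -/
def regRep (F : Arrow X → ℂ) (hF : iNorm F ≠ ∞) : RegOps X :=
  ⟨fun u => regRepAt F hF u, memℓp_infty ⟨(iNorm F).toReal, by
    rintro _ ⟨u, rfl⟩
    exact norm_kernelOp_le (kernelBound_regKernel hF u)⟩⟩

lemma norm_regRep (F : Arrow X → ℂ) (hF : iNorm F ≠ ∞) :
    ‖regRep F hF‖ = ⨆ u, ‖regRepAt F hF u‖ := rfl

lemma regRepAt_apply (F : Arrow X → ℂ) (hF : iNorm F ≠ ∞) (u : X) (ξ : ℓ²(SourceFiber u, ℂ))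
    (γ : SourceFiber u) :
    regRepAt F hF u ξ γ = ∑' η : SourceFiber u, F (Arrow.mk (inv η.2 ≫ γ.2)) * ξ η := rfl

lemma norm_regRep_le (F : Arrow X → ℂ) (hF : iNorm F ≠ ∞) :
    ‖regRep F hF‖ ≤ (iNorm F).toReal :=
  lp.norm_le_of_forall_le ENNReal.toReal_nonneg
    fun u => norm_kernelOp_le (kernelBound_regKernel hF u)

lemma regRep_ext {F : Arrow X → ℂ} {hF : iNorm F ≠ ∞} {T : RegOps X}
    [∀ u : X, DecidableEq (SourceFiber u)]
    (h : ∀ (u : X) (γ η : SourceFiber u),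
      T.1 u (lp.single 2 η 1) γ = F (Arrow.mk (inv η.2 ≫ γ.2))) : regRep F hF = T := by
  refine RegOps.ext fun u => ext_matrix fun γ η => ?_
  rw [h]
  exact kernelOp_single (kernelBound_regKernel hF u) _ _

lemma regRepAt_single {F : Arrow X → ℂ} (hF : iNorm F ≠ ∞) (u : X)
    [DecidableEq (SourceFiber u)] (γ η : SourceFiber u) :
    regRepAt F hF u (lp.single 2 η 1) γ = F (Arrow.mk (inv η.2 ≫ γ.2)) :=
  kernelOp_single (kernelBound_regKernel hF u) _ _

lemma iNorm_le {F : Arrow X → ℂ} {C : ℝ≥0∞}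
    (h1 : ∀ u : X, ∑' γ : SourceFiber u, ‖F (Arrow.mk γ.2)‖ₑ ≤ C)
    (h2 : ∀ u : X, ∑' γ : RangeFiber u, ‖F (Arrow.mk γ.2)‖ₑ ≤ C) : iNorm F ≤ C :=
  iSup_le fun u => max_le (h1 u) (h2 u)

lemma regRep_add {F F' : Arrow X → ℂ} (hF : iNorm F ≠ ∞) (hF' : iNorm F' ≠ ∞)
    (hs : iNorm (F + F') ≠ ∞) : regRep (F + F') hs = regRep F hF + regRep F' hF' := by
  classical
  refine regRep_ext fun u γ η => ?_
  change regRepAt F hF u _ γ + regRepAt F' hF' u _ γ = _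
  rw [regRepAt_single, regRepAt_single, Pi.add_apply]

lemma regRep_smul {F : Arrow X → ℂ} (c : ℂ) (hF : iNorm F ≠ ∞)
    (hs : iNorm (c • F) ≠ ∞) : regRep (c • F) hs = c • regRep F hF := by
  classical
  refine regRep_ext fun u γ η => ?_
  change c • regRepAt F hF u _ γ = _
  rw [regRepAt_single, Pi.smul_apply]

/-- The involution `F^*(γ) = conj (F(γ⁻¹))`. -/
def starFun (F : Arrow X → ℂ) (γ : Arrow X) : ℂ := star (F (invArrow γ))

/-- The convolution `(F * H)(γ) = ∑_{r(η) = r(γ)} F(η) H(η⁻¹ γ)`. -/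
def convFun (F H : Arrow X → ℂ) (γ : Arrow X) : ℂ :=
  ∑' η : RangeFiber γ.right, F (Arrow.mk η.2) * H (Arrow.mk (γ.hom ≫ inv η.2))

lemma regRep_star {F : Arrow X → ℂ} (hF : iNorm F ≠ ∞) (hs : iNorm (starFun F) ≠ ∞) :
    regRep (starFun F) hs = star (regRep F hF) := by
  refine RegOps.ext fun u => ?_
  refine kernelOp_star (kernelBound_regKernel hF u) (kernelBound_regKernel hs u) fun γ η => ?_
  simp [regKernel, starFun, invArrow]

lemma regRep_conv {F H : Arrow X → ℂ} (hF : iNorm F ≠ ∞) (hH : iNorm H ≠ ∞)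
    (hs : iNorm (convFun F H) ≠ ∞) :
    regRep (convFun F H) hs = regRep F hF * regRep H hH := by
  refine RegOps.ext fun u => ?_
  refine kernelOp_mul (kernelBound_regKernel hF u) (kernelBound_regKernel hH u)
    (kernelBound_regKernel hs u) fun γ η => ?_
  simp only [regKernel, convFun]
  refine ((rangeEquiv γ).tsum_eq fun ζ : RangeFiber γ.1 =>
    F (Arrow.mk ζ.2) * H (Arrow.mk ((inv η.2 ≫ γ.2) ≫ inv ζ.2))).symm.trans ?_
  refine tsum_congr fun ζ => ?_
  simp [rangeEquiv]

/-! ### The algebra `C_c(G)` of an étale groupoid -/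

lemma invArrow_invArrow (γ : Arrow X) : invArrow (invArrow γ) = γ := by
  simp [invArrow]

lemma sourceFiber_mk_injective (u : X) :
    Function.Injective fun γ : SourceFiber u => Arrow.mk γ.2 := by
  rintro ⟨y, γ⟩ ⟨z, η⟩ h
  cases h
  rfl

lemma rangeFiber_mk_injective (u : X) :
    Function.Injective fun γ : RangeFiber u => Arrow.mk γ.2 := by
  rintro ⟨y, γ⟩ ⟨z, η⟩ h
  cases h
  rfl

lemma idArrow_injective : Function.Injective (idArrow : X → Arrow X) :=
  fun _ _ h => congrArg (fun γ : Arrow X => γ.left) h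

lemma tsum_le_of_subsingleton {ι : Type*} {F : ι → ℂ} {C : ℝ≥0∞} (hF : ∀ i, ‖F i‖ₑ ≤ C)
    (h : ∀ i j, F i ≠ 0 → F j ≠ 0 → i = j) : ∑' i, ‖F i‖ₑ ≤ C := by
  by_cases h0 : ∃ i, F i ≠ 0
  · obtain ⟨i, hi⟩ := h0
    rw [tsum_eq_single i fun j hj => by
      by_contra hne
      exact hj (h j i (by simpa using hne) hi)]
    exact hF i
  · push Not at h0
    simp [h0]

/-- A bounded function supported in a compact set has uniformly bounded sums over the fibres of
a locally injective map. -/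
lemma exists_tsum_fiber_le {T Y : Type*} [TopologicalSpace T] {p : T → Y}
    (hp : IsLocallyInjective p) {F : T → ℂ} (hF : HasCompactSupport F) {C : ℝ≥0∞} (hC : C ≠ ∞)
    (hFC : ∀ t, ‖F t‖ₑ ≤ C) :
    ∃ M : ℝ≥0∞, M ≠ ∞ ∧ ∀ (ι : Type _) (e : ι → T), Function.Injective e →
      (∀ i j, p (e i) = p (e j)) → ∑' i, ‖F (e i)‖ₑ ≤ M := by
  choose U hUo hU hinj using hp
  obtain ⟨s, -, hs⟩ := IsCompact.elim_nhds_subcover hF U fun x _ => (hUo x).mem_nhds (hU x)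
  refine ⟨∑ _ ∈ s, C, by simp [ENNReal.mul_eq_top, hC], fun ι e he hpe => ?_⟩
  have key : ∀ i, ‖F (e i)‖ₑ ≤ ∑ x ∈ s, ‖(U x).indicator F (e i)‖ₑ := by
    intro i
    by_cases h : F (e i) = 0
    · simp [h]
    · obtain ⟨x, hx, hix⟩ := Set.mem_iUnion₂.1 (hs (subset_tsupport _ h))
      have : ‖F (e i)‖ₑ = ‖(U x).indicator F (e i)‖ₑ := by rw [Set.indicator_of_mem hix]
      rw [this]
      exact Finset.single_le_sum (f := fun x => ‖(U x).indicator F (e i)‖ₑ)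
        (fun _ _ => zero_le) hx
  refine (ENNReal.tsum_le_tsum key).trans ?_
  rw [Summable.tsum_finsetSum fun _ _ => ENNReal.summable]
  refine Finset.sum_le_sum fun x _ => tsum_le_of_subsingleton (fun i => ?_) fun i j hi hj => ?_
  · by_cases h : e i ∈ U x
    · rw [Set.indicator_of_mem h]
      exact hFC _
    · simp [Set.indicator_of_notMem h]
  · exact he (hinj x (Set.mem_of_indicator_ne_zero hi) (Set.mem_of_indicator_ne_zero hj) (hpe i j))

lemma convFun_eq_of_unique {F H : Arrow X → ℂ} {γ η₀ : Arrow X} (h : γ.right = η₀.right)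
    (hu : ∀ η : RangeFiber γ.right, F (Arrow.mk η.2) ≠ 0 → Arrow.mk η.2 = η₀) :
    convFun F H γ = F η₀ * H (compArrow ⟨(γ, invArrow η₀), h⟩) := by
  obtain ⟨x, y, γ, rfl⟩ := Arrow.mk_surjective γ
  obtain ⟨z, w, η₀, rfl⟩ := Arrow.mk_surjective η₀
  have hyw : y = w := h
  subst hyw
  have h1 : compArrow ⟨(Arrow.mk γ, invArrow (Arrow.mk η₀)), h⟩ = Arrow.mk (γ ≫ inv η₀) :=
    compArrow_mk γ (inv η₀) rfl
  rw [h1]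
  change ∑' η : RangeFiber y, F (Arrow.mk η.2) * H (Arrow.mk (γ ≫ inv η.2)) = _
  refine tsum_eq_single (⟨z, η₀⟩ : RangeFiber y) fun η hη => ?_
  by_cases h0 : F (Arrow.mk η.2) = 0
  · simp [h0]
  · exact absurd (rangeFiber_mk_injective y (hu η h0)) hη

/-- The extension by zero of a function on the unit space. -/
def extendUnits (f : X → ℂ) : Arrow X → ℂ := Function.extend idArrow f 0

lemma extendUnits_idArrow (f : X → ℂ) (x : X) : extendUnits f (idArrow x) = f x :=
  idArrow_injective.extend_apply _ _ _

lemma extendUnits_of_notMem (f : X → ℂ) {γ : Arrow X} (h : γ ∉ Set.range idArrow) :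
    extendUnits f γ = 0 :=
  Function.extend_apply' _ _ _ h

lemma iNorm_le_of_units {F : Arrow X → ℂ} {C : ℝ≥0∞} (h : ∀ γ, ‖F γ‖ₑ ≤ C)
    (h0 : ∀ γ ∉ Set.range (idArrow : X → Arrow X), F γ = 0) : iNorm F ≤ C := by
  have key : ∀ γ, F γ ≠ 0 → ∃ x : X, idArrow x = γ := fun γ hγ => by
    by_contra hn
    exact hγ (h0 γ hn)
  refine iNorm_le (fun u => tsum_le_of_subsingleton (fun _ => h _) fun γ η hγ hη => ?_)
    fun u => tsum_le_of_subsingleton (fun _ => h _) fun γ η hγ hη => ?_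
  · obtain ⟨x, hx⟩ := key _ hγ
    obtain ⟨y, hy⟩ := key _ hη
    apply sourceFiber_mk_injective u
    change Arrow.mk γ.2 = Arrow.mk η.2
    rw [← hx, ← hy]
    exact congrArg idArrow ((congrArg (fun γ : Arrow X => γ.left) hx).trans
      (congrArg (fun γ : Arrow X => γ.left) hy).symm)
  · obtain ⟨x, hx⟩ := key _ hγ
    obtain ⟨y, hy⟩ := key _ hη
    apply rangeFiber_mk_injective u
    change Arrow.mk γ.2 = Arrow.mk η.2
    rw [← hx, ← hy]
    exact congrArg idArrow ((congrArg (fun γ : Arrow X => γ.right) hx).trans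
      (congrArg (fun γ : Arrow X => γ.right) hy).symm)

lemma norm_extendUnits_le {f : X → ℂ} {C : ℝ} (hC : 0 ≤ C) (h : ∀ x, ‖f x‖ ≤ C) (γ : Arrow X) :
    ‖extendUnits f γ‖ ≤ C := by
  by_cases hγ : γ ∈ Set.range (idArrow : X → Arrow X)
  · obtain ⟨x, rfl⟩ := hγ
    rw [extendUnits_idArrow]
    exact h x
  · rwa [extendUnits_of_notMem f hγ, norm_zero]

lemma iNorm_le_ofReal_of_units {F : Arrow X → ℂ} {C : ℝ} (h : ∀ γ, ‖F γ‖ ≤ C)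
    (h0 : ∀ γ ∉ Set.range (idArrow : X → Arrow X), F γ = 0) : iNorm F ≤ ENNReal.ofReal C :=
  iNorm_le_of_units (fun γ => by
    rw [← ofReal_norm]
    exact ENNReal.ofReal_le_ofReal (h γ)) h0

lemma norm_apply_le {Y : Type*} [TopologicalSpace Y] (f : C₀(Y, ℂ)) (x : Y) : ‖f x‖ ≤ ‖f‖ := by
  rw [← ZeroAtInftyContinuousMap.norm_toBCF_eq_norm]
  exact f.toBCF.norm_coe_le_norm x

lemma iNorm_extendUnits_ne_top [TopologicalSpace X] (f : C₀(X, ℂ)) : iNorm (extendUnits f) ≠ ∞ :=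
  ne_top_of_le_ne_top ENNReal.ofReal_ne_top (iNorm_le_ofReal_of_units
    (norm_extendUnits_le (norm_nonneg f) (norm_apply_le f)) fun _ h => extendUnits_of_notMem _ h)

variable [TopologicalSpace X] [TopologicalSpace (Arrow X)] [IsEtaleGroupoid X]

lemma continuous_source : Continuous fun γ : Arrow X => γ.left :=
  (IsEtaleGroupoid.isLocalHomeomorph_source (X := X)).continuous

lemma continuous_invArrow : Continuous (invArrow : Arrow X → Arrow X) :=
  IsTopologicalGroupoid.continuous_invArrow

lemma isLocalHomeomorph_range : IsLocalHomeomorph fun γ : Arrow X => γ.right :=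
  (IsEtaleGroupoid.isLocalHomeomorph_source (X := X)).comp
    (Homeomorph.isLocalHomeomorph
      { toFun := invArrow
        invFun := invArrow
        left_inv := invArrow_invArrow
        right_inv := invArrow_invArrow
        continuous_toFun := continuous_invArrow
        continuous_invFun := continuous_invArrow })

lemma continuous_range : Continuous fun γ : Arrow X => γ.right :=
  isLocalHomeomorph_range.continuous

lemma isOpenEmbedding_idArrow : IsOpenEmbedding (idArrow : X → Arrow X) :=
  IsLocalHomeomorph.isOpenEmbedding_of_comp (IsEtaleGroupoid.isLocalHomeomorph_source (X := X))
    (g := fun γ : Arrow X => γ.left) IsOpenEmbedding.id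
    IsTopologicalGroupoid.isInducing_idArrow.continuous

/-- The fibrewise sums of a compactly supported continuous function on an étale groupoid are
uniformly bounded. -/
lemma iNorm_ne_top {F : Arrow X → ℂ} (hF : Continuous F) (hc : HasCompactSupport F) :
    iNorm F ≠ ∞ := by
  obtain ⟨C, hC⟩ := hc.exists_bound_of_continuous hF
  have hC' : ∀ t, ‖F t‖ₑ ≤ ENNReal.ofReal C := fun t => by
    rw [← ofReal_norm]
    exact ENNReal.ofReal_le_ofReal (hC t)
  obtain ⟨M, hM, h1⟩ := exists_tsum_fiber_le
    (IsEtaleGroupoid.isLocalHomeomorph_source (X := X)).isLocallyInjective hc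
    ENNReal.ofReal_ne_top hC'
  obtain ⟨M', hM', h2⟩ := exists_tsum_fiber_le
    (isLocalHomeomorph_range (X := X)).isLocallyInjective hc ENNReal.ofReal_ne_top hC'
  refine ne_top_of_le_ne_top (b := max M M') (by simp [hM, hM']) (iNorm_le (fun u => ?_) fun u => ?_)
  · exact (h1 _ _ (sourceFiber_mk_injective u) fun _ _ => rfl).trans (le_max_left _ _)
  · exact (h2 _ _ (rangeFiber_mk_injective u) fun _ _ => rfl).trans (le_max_right _ _)

lemma hasCompactSupport_starFun {F : Arrow X → ℂ} (hc : HasCompactSupport F) :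
    HasCompactSupport (starFun F) := by
  have h : HasCompactSupport (F ∘ invArrow) := hc.comp_homeomorph
      { toFun := invArrow
        invFun := invArrow
        left_inv := invArrow_invArrow
        right_inv := invArrow_invArrow
        continuous_toFun := continuous_invArrow
        continuous_invFun := continuous_invArrow }
  exact h.comp_left (g := star) (star_zero ℂ)

lemma t2Space_units [T2Space (Arrow X)] : T2Space X :=
  (isOpenEmbedding_idArrow (X := X)).isEmbedding.t2Space

lemma isClosed_range_idArrow [T2Space (Arrow X)] : IsClosed (Set.range (idArrow : X → Arrow X)) := by
  have h : Set.range (idArrow : X → Arrow X) = {γ | idArrow γ.left = γ} := by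
    ext γ
    refine ⟨?_, fun h => ⟨_, h⟩⟩
    rintro ⟨x, rfl⟩
    rfl
  rw [h]
  exact isClosed_eq (isOpenEmbedding_idArrow.continuous.comp continuous_source) continuous_id

lemma continuous_extendUnits [T2Space (Arrow X)] {f : X → ℂ} (hf : Continuous f) : Continuous (extendUnits f) := by
  classical
  have h : extendUnits f = (Set.range (idArrow : X → Arrow X)).indicator fun γ => f γ.left := by
    funext γ
    by_cases hγ : γ ∈ Set.range (idArrow : X → Arrow X)
    · rw [Set.indicator_of_mem hγ]
      obtain ⟨x, rfl⟩ := hγ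
      exact extendUnits_idArrow f x
    · rw [Set.indicator_of_notMem hγ, extendUnits_of_notMem f hγ]
  rw [h]
  exact (hf.comp continuous_source).indicator fun γ hγ => by
    rw [IsClopen.frontier_eq ⟨isClosed_range_idArrow, isOpenEmbedding_idArrow.isOpen_range⟩] at hγ
    exact hγ.elim

lemma hasCompactSupport_convFun [T2Space (Arrow X)] {F H : Arrow X → ℂ}
    (hF : HasCompactSupport F) (hH : HasCompactSupport H) : HasCompactSupport (convFun F H) := by
  have : T2Space X := t2Space_units
  have hcl : IsClosed {p : Arrow X × Arrow X | p.1.right = p.2.left} :=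
    isClosed_eq (continuous_range.comp continuous_fst) (continuous_source.comp continuous_snd)
  have hK : IsCompact ((fun p : ComposablePairs X => p.1) ⁻¹' (tsupport H ×ˢ tsupport F)) :=
    hcl.isClosedEmbedding_subtypeVal.isCompact_preimage (IsCompact.prod hH hF)
  refine HasCompactSupport.intro
    (hK.image (IsTopologicalGroupoid.continuous_compArrow (X := X))) fun γ hγ => ?_
  by_contra hne
  apply hγ
  obtain ⟨η, hη⟩ : ∃ η : RangeFiber γ.right,
      F (Arrow.mk η.2) * H (Arrow.mk (γ.hom ≫ inv η.2)) ≠ 0 := by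
    by_contra h
    push Not at h
    exact hne (by simp [convFun, h])
  refine ⟨⟨(Arrow.mk (γ.hom ≫ inv η.2), Arrow.mk η.2), rfl⟩,
    ⟨subset_tsupport _ (right_ne_zero_of_mul hη), subset_tsupport _ (left_ne_zero_of_mul hη)⟩, ?_⟩
  rw [compArrow_mk]
  simp


lemma continuous_convFun_of_bisection [T2Space (Arrow X)] {e : OpenPartialHomeomorph (Arrow X) X}
    (he : ∀ γ, e γ = γ.right) {F H : Arrow X → ℂ} (hF : Continuous F) (hc : HasCompactSupport F)
    (hs : tsupport F ⊆ e.source) (hH : Continuous H) : Continuous (convFun F H) := by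
  have : T2Space X := t2Space_units
  have hsupp : ∀ {η : Arrow X}, F η ≠ 0 → η ∈ e.source := fun h => hs (subset_tsupport _ h)
  rw [continuous_iff_continuousAt]
  intro γ₀
  by_cases hγ : γ₀.right ∈ e.target
  · have hV : IsOpen {γ : Arrow X | γ.right ∈ e.target} := e.open_target.preimage continuous_range
    refine ContinuousOn.continuousAt ?_ (hV.mem_nhds hγ)
    rw [continuousOn_iff_continuous_domRestrict]
    have hr : ∀ v : {γ : Arrow X | γ.right ∈ e.target}, v.1.right = (e.symm v.1.right).right :=
      fun v => (e.right_inv v.2).symm.trans (he _)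
    have hcs : Continuous fun v : {γ : Arrow X | γ.right ∈ e.target} => e.symm v.1.right :=
      e.continuousOn_symm.comp_continuous (continuous_range.comp continuous_subtype_val)
        fun v => v.2
    have heq : {γ : Arrow X | γ.right ∈ e.target}.domRestrict (convFun F H) = fun v =>
        F (e.symm v.1.right) *
          H (compArrow ⟨(v.1, invArrow (e.symm v.1.right)), hr v⟩) := by
      funext v
      refine convFun_eq_of_unique (hr v) fun η hη => ?_
      have h1 := e.left_inv (hsupp hη)
      rw [he] at h1
      exact h1.symm
    rw [heq]
    refine (hF.comp hcs).mul (hH.comp (IsTopologicalGroupoid.continuous_compArrow.comp ?_))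
    exact Continuous.subtype_mk
      (continuous_subtype_val.prodMk (continuous_invArrow.comp hcs)) _
  · have hcl : IsClosed ((fun γ : Arrow X => γ.right) ⁻¹' ((fun γ : Arrow X => γ.right) '' tsupport F)) :=
      (IsCompact.image hc continuous_range).isClosed.preimage continuous_range
    have hmem : γ₀ ∉ (fun γ : Arrow X => γ.right) ⁻¹' ((fun γ : Arrow X => γ.right) '' tsupport F) := by
      rintro ⟨η, hη, h⟩
      apply hγ
      rw [← show η.right = γ₀.right from h, ← he]
      exact e.map_source (hs hη)
    have hev : convFun F H =ᶠ[𝓝 γ₀] fun _ => 0 := by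
      filter_upwards [hcl.isOpen_compl.mem_nhds hmem] with γ hγ'
      have : ∀ η : RangeFiber γ.right, F (Arrow.mk η.2) = 0 := fun η => by
        by_contra h
        exact hγ' ⟨Arrow.mk η.2, subset_tsupport _ h, rfl⟩
      simp [convFun, this]
    exact continuousAt_const.congr hev.symm

lemma continuous_convFun [T2Space (Arrow X)] [LocallyCompactSpace (Arrow X)] {F H : Arrow X → ℂ}
    (hF : Continuous F) (hc : HasCompactSupport F) (hH : Continuous H) :
    Continuous (convFun F H) := by
  choose e hx he using isLocalHomeomorph_range (X := X)
  have he' : ∀ γ η : Arrow X, e γ η = η.right := fun γ η => (congrFun (he γ) η).symm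
  obtain ⟨s, -, hs⟩ := IsCompact.elim_nhds_subcover hc (fun γ => (e γ).source)
    fun γ _ => (e γ).open_source.mem_nhds (hx γ)
  obtain ⟨ρ, hρs, hρ1, -, hρc⟩ := exists_continuous_sum_one_of_isOpen_isCompact
    (s := fun i : Fin s.card => (e (s.equivFin.symm i)).source)
    (fun i => (e _).open_source) hc (fun γ hγ => by
      obtain ⟨x, hx, h⟩ := Set.mem_iUnion₂.1 (hs hγ)
      exact Set.mem_iUnion.2 ⟨s.equivFin ⟨x, hx⟩, by simpa using h⟩)
  let Fi : Fin s.card → Arrow X → ℂ := fun i γ => (ρ i γ : ℂ) * F γ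
  have hFic : ∀ i, Continuous (Fi i) := fun i =>
    (Complex.continuous_ofReal.comp (ρ i).continuous).mul hF
  have hFis : ∀ i, tsupport (Fi i) ⊆ (e (s.equivFin.symm i)).source := fun i =>
    (closure_mono fun γ hγ => by
      have := left_ne_zero_of_mul hγ
      simpa using this : tsupport (Fi i) ⊆ tsupport (ρ i)).trans (hρs i)
  have hFicc : ∀ i, HasCompactSupport (Fi i) := fun i => HasCompactSupport.mul_left hc
  have hsum : ∀ γ, F γ = ∑ i, Fi i γ := by
    intro γ
    by_cases h : γ ∈ tsupport F
    · have h1 : ∑ i, ρ i γ = 1 := by simpa using hρ1 h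
      simp only [Fi, ← Finset.sum_mul, ← Complex.ofReal_sum, h1, Complex.ofReal_one, one_mul]
    · simp [Fi, image_eq_zero_of_notMem_tsupport h]
  have hconv : convFun F H = fun γ => ∑ i, convFun (Fi i) H γ := by
    funext γ
    simp only [convFun]
    rw [← Summable.tsum_finsetSum]
    · exact tsum_congr fun η => by rw [hsum, Finset.sum_mul]
    · intro i _
      refine summable_of_hasFiniteSupport (Set.Subsingleton.finite fun η hη ζ hζ => ?_)
      have h1 := hFis i (subset_tsupport _ (left_ne_zero_of_mul hη))
      have h2 := hFis i (subset_tsupport _ (left_ne_zero_of_mul hζ))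
      refine rangeFiber_mk_injective _ ((e _).injOn h1 h2 ?_)
      exact (he' _ _).trans (he' _ (Arrow.mk ζ.2)).symm
  rw [hconv]
  exact continuous_finsetSum _ fun i _ =>
    continuous_convFun_of_bisection (he' _) (hFic i) (hFicc i) (hFis i) hH

/-! ### The reduced C*-algebra -/

/-- The image of `f ∈ C_c(G)` under the direct sum of all the regular representations. -/
def regRepCc (f : C_c(Arrow X, ℂ)) : RegOps X :=
  regRep f (iNorm_ne_top f.continuous f.hasCompactSupport)

variable [T2Space (Arrow X)] [LocallyCompactSpace (Arrow X)]

variable (X) in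
/-- The `*`-algebra `C_c(G)` with convolution and involution, in its image under the direct sum
of the regular representations. -/
def regImage : NonUnitalStarSubalgebra ℂ (RegOps X) where
  carrier := Set.range regRepCc
  add_mem' := by
    rintro _ _ ⟨f, rfl⟩ ⟨g, rfl⟩
    exact ⟨f + g, regRep_add _ _ _⟩
  zero_mem' := ⟨0, by
    have h := regRep_smul (0 : ℂ) (iNorm_ne_top (X := X) (0 : C_c(Arrow X, ℂ)).continuous
      (0 : C_c(Arrow X, ℂ)).hasCompactSupport) (by simp [iNorm])
    simpa [regRepCc] using h⟩
  smul_mem' := by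
    rintro c _ ⟨f, rfl⟩
    exact ⟨c • f, regRep_smul _ _ _⟩
  mul_mem' := by
    rintro _ _ ⟨f, rfl⟩ ⟨g, rfl⟩
    exact ⟨⟨⟨convFun f g, continuous_convFun f.continuous f.hasCompactSupport g.continuous⟩,
      hasCompactSupport_convFun f.hasCompactSupport g.hasCompactSupport⟩, regRep_conv _ _ _⟩
  star_mem' := by
    rintro _ ⟨f, rfl⟩
    exact ⟨⟨⟨starFun f, continuous_star.comp (f.continuous.comp continuous_invArrow)⟩,
      hasCompactSupport_starFun f.hasCompactSupport⟩, regRep_star _ _⟩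

variable (X) in
/-- The reduced C*-algebra `C*_r(G)`: the completion of `C_c(G)` in the norm
`‖f‖_r = sup_u ‖π_u(f)‖`, realized as the closure of the image of `C_c(G)` in the bounded families
of operators with the supremum norm. -/
def ReducedCStarAlgebra : Type _ := (regImage X).topologicalClosure

instance : NonUnitalCStarAlgebra (ReducedCStarAlgebra X) :=
  NonUnitalStarSubalgebra.nonUnitalCStarAlgebra (regImage X).topologicalClosure
    (h_closed := (regImage X).isClosed_topologicalClosure)

/-- The usual order of a C*-algebra: `a ≤ b` if `b - a` is self-adjoint with nonnegative
spectrum. -/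
instance : PartialOrder (ReducedCStarAlgebra X) := CStarAlgebra.spectralOrder _

instance : StarOrderedRing (ReducedCStarAlgebra X) := CStarAlgebra.spectralOrderedRing _

/-- The canonical map `C_c(G) → C*_r(G)`. -/
def ofCc (f : C_c(Arrow X, ℂ)) : ReducedCStarAlgebra X :=
  ⟨regRepCc f, (regImage X).le_topologicalClosure ⟨f, rfl⟩⟩

/-! ### The embedding of `C₀(G⁽⁰⁾)` -/

lemma regRep_extendUnits_mem (f : C₀(X, ℂ)) :
    regRep (extendUnits f) (iNorm_extendUnits_ne_top f) ∈ (regImage X).topologicalClosure := by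
  change _ ∈ closure (Set.range (regRepCc (X := X)))
  rw [Metric.mem_closure_range_iff]
  intro ε hε
  have hK : IsCompact {x : X | ε / 2 ≤ ‖f x‖} := by
    have h := f.zero_at_infty'
    rw [Metric.tendsto_nhds] at h
    obtain ⟨K, hK, hKs⟩ := Filter.mem_cocompact.1 (h (ε / 2) (by positivity))
    refine hK.of_isClosed_subset (isClosed_le continuous_const f.continuous.norm) fun x hx => ?_
    by_contra hxK
    have h2 : dist (f x) 0 < ε / 2 := hKs hxK
    rw [dist_zero_right] at h2
    exact absurd hx (not_le.2 h2)
  obtain ⟨φ, hφ1, -, hφc, hφ⟩ := exists_continuous_one_zero_of_isCompact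
    (hK.image (isOpenEmbedding_idArrow (X := X)).continuous) isClosed_empty
    (Set.disjoint_empty _)
  have hg : Continuous fun γ => (φ γ : ℂ) * extendUnits f γ :=
    (Complex.continuous_ofReal.comp φ.continuous).mul (continuous_extendUnits f.continuous)
  have hgc : HasCompactSupport fun γ => (φ γ : ℂ) * extendUnits f γ :=
    HasCompactSupport.mul_right (hφc.comp_left (g := fun r : ℝ => (r : ℂ)) Complex.ofReal_zero)
  let g : C_c(Arrow X, ℂ) := ⟨⟨_, hg⟩, hgc⟩
  refine ⟨g, ?_⟩
  let D : Arrow X → ℂ := fun γ => (1 - φ γ : ℝ) * extendUnits f γ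
  have hD : iNorm D ≤ ENNReal.ofReal (ε / 2) := by
    refine iNorm_le_ofReal_of_units (fun γ => ?_) fun γ hγ => ?_
    · by_cases hγ : γ ∈ Set.range (idArrow : X → Arrow X)
      · obtain ⟨x, rfl⟩ := hγ
        simp only [D, extendUnits_idArrow, norm_mul, Complex.norm_real]
        have hb := hφ (idArrow x)
        by_cases hx : ε / 2 ≤ ‖f x‖
        · have : φ (idArrow x) = 1 := hφ1 ⟨x, hx, rfl⟩
          simp only [this, sub_self, norm_zero, zero_mul]
          positivity
        · have h1 : ‖1 - φ (idArrow x)‖ ≤ 1 := by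
            rw [Real.norm_eq_abs, abs_le]
            constructor <;> linarith [hb.1, hb.2]
          calc _ ≤ 1 * ‖f x‖ := by gcongr
            _ ≤ ε / 2 := by linarith
      · simp only [D, extendUnits_of_notMem _ hγ, mul_zero, norm_zero]
        positivity
    · simp [D, extendUnits_of_notMem _ hγ]
  have hDt : iNorm D ≠ ∞ := ne_top_of_le_ne_top ENNReal.ofReal_ne_top hD
  have hsum : extendUnits f = D + ⇑g := by
    funext γ
    change _ = ((1 - φ γ : ℝ) : ℂ) * extendUnits f γ + (φ γ : ℂ) * extendUnits f γ
    push_cast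
    ring
  have hgt := iNorm_ne_top g.continuous g.hasCompactSupport
  have hst : iNorm (D + ⇑g) ≠ ∞ := hsum ▸ iNorm_extendUnits_ne_top f
  have heq : regRep (extendUnits f) (iNorm_extendUnits_ne_top f) = regRep D hDt + regRepCc g := by
    refine Eq.trans ?_ (regRep_add hDt hgt hst)
    congr 1
  rw [heq, dist_eq_norm, add_sub_cancel_right]
  calc ‖regRep D hDt‖ ≤ (iNorm D).toReal := norm_regRep_le D hDt
    _ ≤ ε / 2 := ENNReal.toReal_le_of_le_ofReal (by positivity) hD
    _ < ε := by linarith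

/-- The embedding `C₀(G⁽⁰⁾) → C*_r(G)`, given by extending functions by zero. -/
def ofC0 (f : C₀(X, ℂ)) : ReducedCStarAlgebra X :=
  ⟨regRep (extendUnits f) (iNorm_extendUnits_ne_top f), regRep_extendUnits_mem f⟩

end Groupoid

/-! ### Comparison of positive elements -/

section CStar

variable {A : Type*} [NonUnitalCStarAlgebra A]

/-- Cuntz comparison `a ≾ b` of matrices over `A`: `x_kᴴ b x_k → a` for some sequence of
rectangular matrices `x_k`. The topology of `CStarMatrix` is that of its C*-norm. -/
def CuntzBelow {m n : ℕ} (a : CStarMatrix (Fin n) (Fin n) A) (b : CStarMatrix (Fin m) (Fin m) A) :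
    Prop :=
  ∃ x : ℕ → CStarMatrix (Fin m) (Fin n) A,
    Tendsto (fun k => (x k).conjTranspose * b * x k) atTop (𝓝 a)

/-- An element of `A` as a `1 × 1` matrix. -/
def oneByOne (a : A) : CStarMatrix (Fin 1) (Fin 1) A := CStarMatrix.ofMatrix !![a]

/-- The matrix `a ⊕ b`. -/
def directSum (a b : A) : CStarMatrix (Fin 2) (Fin 2) A := CStarMatrix.ofMatrix !![a, 0; 0, b]

/-- A positive element `a` is infinite if `a ⊕ b ≾ a` for some nonzero positive `b`. -/
def IsInfinite [PartialOrder A] (a : A) : Prop :=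
  0 ≤ a ∧ ∃ b : A, 0 ≤ b ∧ b ≠ 0 ∧ CuntzBelow (directSum a b) (oneByOne a)

/-- `A` is purely infinite if it has no characters and, for positive `a` and `b`, one has `a ≾ b`
if and only if `a` lies in the closed two-sided ideal generated by `b`, the closed linear span of
the products `x b y`. -/
def IsPurelyInfinite (A : Type*) [NonUnitalCStarAlgebra A] [PartialOrder A] : Prop :=
  IsEmpty (WeakDual.characterSpace ℂ A) ∧
    ∀ a b : A, 0 ≤ a → 0 ≤ b →
      (CuntzBelow (oneByOne a) (oneByOne b) ↔
        a ∈ closure (Submodule.span ℂ {z : A | ∃ x y : A, z = x * b * y} : Set A))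

end CStar

end GroupoidCStar

end

/-! Two mechanisms carry both directions. Topological principality brings positive elements down to
the unit space: approximate a nonzero positive `b` by some `F` in `C_c(G)` and cut down near a unit
with trivial isotropy. Only the diagonal part of `F` survives there, so `b` dominates a nonzero
positive function (`exists_ofC0_below`). Minimality spreads such a function out: conjugating by
functions supported on bisections moves it to any point, finitely many conjugates dominate any
compactly supported function, and so a closed, conjugation-invariant cone containing all conjugates
of the function contains all positive elements (`star_mul_self_mem`).

If `f` is infinite, with `f ⊕ d ≾ f`, the set `absorbed f` of all `c` with `f ⊕ c ≾ f` is such a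
cone. It contains `d`, hence the conjugates of a function below `d`, hence everything positive. So
every positive `a` lies below every nonzero positive function, and therefore below every nonzero
positive `b`. A character vanishes on a function that absorbs itself, hence on every positive
element below it, so there are no characters.

Conversely, the closed ideal generated by a nonzero positive function `g` is again such a cone, so
pure infiniteness gives `a ≾ g` for all positive `a`. If `f` is nonzero at two points, cut it into
orthogonal nonzero pieces: `f` fits below one piece and the other is left over
(`isInfinite_of_two_points`). If `f` were nonzero at one point only, that point would be isolated
with trivial isotropy, and its indicator would be a projection `e` with one-dimensional corner
dominating every positive element. Then `T ↦ eTe` is a character (`corner_mul`), which pure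
infiniteness forbids. -/

noncomputable section

namespace GroupoidCStar

/-! ### Cuntz comparison in a general C*-algebra -/

section Comparison

variable {A : Type*} [NonUnitalCStarAlgebra A]

/-- `a` is a limit of elements `x⋆ b x`. -/
def Below (a b : A) : Prop :=
  a ∈ closure (Set.range fun x : A => star x * b * x)

lemma below_of_closure_conj {a b : A} {S : Set A} (hS : ∀ s ∈ S, Below s b) (ha : a ∈ closure S) :
    Below a b :=
  closure_minimal hS isClosed_closure ha

lemma Below.conj {a b : A} (h : Below a b) (x : A) : Below (star x * a * x) b := by
  refine map_mem_closure (f := fun z => star x * z * x) (by fun_prop) h ?_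
  rintro _ ⟨y, rfl⟩
  exact ⟨y * x, by simp [mul_assoc]⟩

lemma Below.trans {a b c : A} (h : Below a b) (h' : Below b c) : Below a c := by
  refine below_of_closure_conj ?_ h
  rintro _ ⟨x, rfl⟩
  exact h'.conj x

lemma below_conj (b x : A) : Below (star x * b * x) b := subset_closure ⟨x, rfl⟩

lemma cuntzBelow_oneByOne {a b : A} : CuntzBelow (oneByOne a) (oneByOne b) ↔ Below a b := by
  constructor
  · rintro ⟨x, hx⟩
    have h : Tendsto (fun k => ((x k).conjTranspose * oneByOne b * x k) 0 0) atTop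
        (𝓝 (oneByOne a 0 0)) := tendsto_pi_nhds.1 (tendsto_pi_nhds.1 hx 0) 0
    refine mem_closure_of_tendsto h (Eventually.of_forall fun k => ⟨x k 0 0, ?_⟩)
    simp [CStarMatrix.mul_apply, oneByOne]
  · intro h
    obtain ⟨y, hy, hlim⟩ := mem_closure_iff_seq_limit.1 h
    choose x hx using hy
    refine ⟨fun k => CStarMatrix.ofMatrix !![x k], ?_⟩
    refine tendsto_pi_nhds.2 fun i => tendsto_pi_nhds.2 fun j => ?_
    fin_cases i; fin_cases j
    refine hlim.congr fun k => ?_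
    rw [← hx k]
    simp [CStarMatrix.mul_apply, oneByOne]

/-- The entries of the matrices `(x, y)ᴴ c (x, y)` for pairs `(x, y)`. -/
def pairEntries (c : A) : Set (A × A × A) :=
  Set.range fun p : A × A => (star p.1 * c * p.1, star p.1 * c * p.2, star p.2 * c * p.2)

/-- Matrix convergence is entrywise. Three entries suffice, because for self-adjoint `c` the lower
left entry is the adjoint of the upper right one. -/
lemma cuntzBelow_directSum {a b c : A} (hc : IsSelfAdjoint c) :
    CuntzBelow (directSum a b) (oneByOne c) ↔ (a, 0, b) ∈ closure (pairEntries c) := by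
  constructor
  · rintro ⟨x, hx⟩
    have h : ∀ i j, Tendsto (fun k => ((x k).conjTranspose * oneByOne c * x k) i j) atTop
        (𝓝 (directSum a b i j)) := fun i j => tendsto_pi_nhds.1 (tendsto_pi_nhds.1 hx i) j
    refine mem_closure_of_tendsto ((h 0 0).prodMk_nhds ((h 0 1).prodMk_nhds (h 1 1)))
      (Eventually.of_forall fun k => ⟨(x k 0 0, x k 0 1), ?_⟩)
    simp [CStarMatrix.mul_apply, oneByOne]
  · intro h
    obtain ⟨y, hy, hlim⟩ := mem_closure_iff_seq_limit.1 h
    choose x hx using hy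
    refine ⟨fun k => CStarMatrix.ofMatrix !![(x k).1, (x k).2], ?_⟩
    have h1 := (continuous_fst.tendsto _).comp hlim
    have h2 := (continuous_fst.tendsto _).comp ((continuous_snd.tendsto _).comp hlim)
    have h3 := (continuous_snd.tendsto _).comp ((continuous_snd.tendsto _).comp hlim)
    have h4 := (continuous_star.tendsto _).comp h2
    refine tendsto_pi_nhds.2 fun i => tendsto_pi_nhds.2 fun j => ?_
    fin_cases i <;> fin_cases j
    · refine h1.congr fun k => ?_
      simp [CStarMatrix.mul_apply, oneByOne, ← hx k]
    · refine h2.congr fun k => ?_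
      simp [CStarMatrix.mul_apply, oneByOne, ← hx k]
    · rw [show star (a, (0 : A), b).2.1 = 0 from star_zero A] at h4
      refine h4.congr fun k => ?_
      simp [CStarMatrix.mul_apply, oneByOne, ← hx k, hc.star_eq, mul_assoc]
    · refine h3.congr fun k => ?_
      simp [CStarMatrix.mul_apply, oneByOne, ← hx k]

/-- The elements `c` with `h ⊕ c ≾ h`. -/
def absorbed (h : A) : Set A := {c | (h, 0, c) ∈ closure (pairEntries h)}

lemma isClosed_absorbed (h : A) : IsClosed (absorbed h) :=
  isClosed_closure.preimage (by fun_prop : Continuous fun c : A => (h, (0 : A), c))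

lemma absorbed_conj {h c : A} (hc : c ∈ absorbed h) (w : A) : star w * c * w ∈ absorbed h := by
  have hm : ∀ p ∈ pairEntries h, (p.1, p.2.1 * w, star w * p.2.2 * w) ∈ pairEntries h := by
    rintro _ ⟨⟨x, y⟩, rfl⟩
    exact ⟨(x, y * w), by simp [mul_assoc]⟩
  have := map_mem_closure (f := fun p : A × A × A => (p.1, p.2.1 * w, star w * p.2.2 * w))
    (by fun_prop) hc hm
  simpa [absorbed] using this

/-- Absorption can be iterated: `h ⊕ (c + d) ≾ h` follows by using a pair for `d` inside the copy of
`h` that a pair for `c` reproduces. -/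
lemma absorbed_add {h c d : A} (hh : IsSelfAdjoint h) (hc : c ∈ absorbed h)
    (hd : d ∈ absorbed h) : c + d ∈ absorbed h := by
  have key : ∀ p ∈ pairEntries h, (p.1, p.2.1, c + p.2.2) ∈ closure (pairEntries h) := by
    rintro _ ⟨⟨x, y⟩, rfl⟩
    -- These are the entries of the composite pair `(x' * x, x' * y + y')`. As the entries of `(x',
    -- y')` tend to `(h, 0, c)`, they tend to those of `(x, y)` with `c` added in the last place.
    have hm : ∀ p ∈ pairEntries h, (star x * p.1 * x, star x * p.1 * y + star x * p.2.1,
        star y * p.1 * y + star y * p.2.1 + star p.2.1 * y + p.2.2) ∈ pairEntries h := by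
      rintro _ ⟨⟨x', y'⟩, rfl⟩
      refine ⟨(x' * x, x' * y + y'), ?_⟩
      simp only [star_add, star_mul, star_star, mul_assoc, mul_add, add_mul, hh.star_eq,
        Prod.mk.injEq, true_and]
      abel
    have := map_mem_closure (f := fun p : A × A × A => (star x * p.1 * x,
      star x * p.1 * y + star x * p.2.1,
      star y * p.1 * y + star y * p.2.1 + star p.2.1 * y + p.2.2)) (by fun_prop) hc hm
    simpa [add_comm] using this
  have := closure_minimal (t := (fun p : A × A × A => (p.1, p.2.1, c + p.2.2)) ⁻¹'
    closure (pairEntries h)) key (isClosed_closure.preimage (by fun_prop)) hd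
  exact this

lemma below_of_mem_absorbed {h c : A} (hc : c ∈ absorbed h) : Below c h :=
  map_mem_closure (f := fun p : A × A × A => p.2.2) (t := Set.range fun x => star x * h * x)
    (by fun_prop) hc (by rintro _ ⟨⟨x, y⟩, rfl⟩; exact ⟨y, rfl⟩)

/-- A multiplicative functional vanishes on an element that absorbs itself. -/
lemma map_eq_zero_of_self_mem_absorbed {h : A} (hh : IsSelfAdjoint h) (hs : h ∈ absorbed h)
    {χ : A → ℂ} (hχ : Continuous χ) (hmul : ∀ x y, χ (x * y) = χ x * χ y) (h0 : χ 0 = 0) :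
    χ h = 0 := by
  -- A multiplicative functional turns the matrix of a pair into one of determinant zero. In the
  -- limit `(h, 0, h)` the determinant is `χ h ^ 2`.
  have hm : ∀ p ∈ pairEntries h, χ p.1 * χ p.2.2 - χ p.2.1 * χ (star p.2.1) = 0 := by
    rintro _ ⟨⟨x, y⟩, rfl⟩
    simp only [star_mul, star_star, hmul, hh.star_eq]
    ring
  have := closure_minimal (t := {p : A × A × A | χ p.1 * χ p.2.2 - χ p.2.1 * χ (star p.2.1) = 0})
    hm (isClosed_eq (by fun_prop) continuous_const) hs
  simpa [h0] using this

variable [PartialOrder A] [StarOrderedRing A]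

/-- Comparison is implied by the order. -/
lemma below_of_le {a b : A} (ha : 0 ≤ a) (hab : a ≤ b) : Below a b := by
  rw [Below, Metric.mem_closure_range_iff]
  intro ε hε
  set B := Unitization ℂ A
  have hb : (0 : B) ≤ (b : B) := (Unitization.inr_nonneg_iff).2 (ha.trans hab)
  have ha' : (0 : B) ≤ (a : B) := (Unitization.inr_nonneg_iff).2 ha
  have hab' : (a : B) ≤ (b : B) :=
    (Unitization.inr_le_iff a b ha.isSelfAdjoint (ha.trans hab).isSelfAdjoint).2 hab
  set δ : ℝ := ε / 2
  have hδ : 0 < δ := by positivity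
  have hsp : IsStrictlyPositive (algebraMap ℝ B δ + (b : B)) :=
    (isStrictlyPositive_algebraMap (A := B) hδ).add_nonneg hb
  set c := algebraMap ℝ B δ + (b : B)
  -- In the unitization, `z = (b + δ)^(-1/2)` and `x = z a^(1/2)` give `a - x⋆ b x = δ a^(1/2) z²
  -- a^(1/2)`. By the C*-identity its norm is `δ ‖z a z‖`, at most `δ` since `z a z ≤ z b z ≤ 1`.
  set z : B := c ^ (-(1 / 2) : ℝ)
  have hz : IsSelfAdjoint z := CFC.rpow_nonneg.isSelfAdjoint
  have h1 : z * c * z = 1 := CFC.conjugate_rpow_neg_one_half c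
  have h2 : z * (b : B) * z = 1 - δ • (z * z) := by
    rw [← h1]
    simp [c, Algebra.algebraMap_eq_smul_one, mul_add, add_mul]
  have hzb : z * (a : B) * z ≤ 1 := by
    calc z * (a : B) * z ≤ z * (b : B) * z := hz.conjugate_le_conjugate hab'
      _ = 1 - δ • (z * z) := h2
      _ ≤ 1 := by
        rw [sub_le_self_iff]
        have : 0 ≤ star z * z := star_mul_self_nonneg z
        rw [hz.star_eq] at this
        exact smul_nonneg hδ.le this
  have hzn : ‖z * (a : B) * z‖ ≤ 1 :=
    (CStarAlgebra.norm_le_one_iff_of_nonneg _ (hz.conjugate_nonneg ha')).2 hzb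
  set s := CFC.sqrt a
  have hs : IsSelfAdjoint s := (CFC.sqrt_nonneg a).isSelfAdjoint
  have hss : s * s = a := CFC.sqrt_mul_sqrt_self a
  have hs' : star (s : B) = s := by rw [← Unitization.inr_star, hs.star_eq]
  have hss' : (s : B) * s = a := by rw [← Unitization.inr_mul, hss]
  -- The product `z * s` already lies in `A`, which is an ideal of its unitization.
  set x := (z * (s : B)).snd
  have hx : (x : B) = z * (s : B) := by
    ext
    · change 0 = (z * (s : B)).fst
      rw [Unitization.fst_mul, Unitization.fst_inr, mul_zero]
    · rfl
  refine ⟨x, ?_⟩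
  rw [dist_eq_norm, ← Unitization.norm_inr (𝕜 := ℂ)]
  have h3 : ((a - star x * b * x : A) : B) = δ • (star (z * (s : B)) * (z * s)) := by
    rw [sub_eq_add_neg, Unitization.inr_add, Unitization.inr_neg, ← sub_eq_add_neg,
      Unitization.inr_mul, Unitization.inr_mul, Unitization.inr_star, hx, star_mul, hs', hz.star_eq,
      show (s : B) * z * b * (z * s) = s * (z * b * z) * s by simp only [mul_assoc], h2, ← hss']
    simp [mul_sub, sub_mul, mul_assoc]
  rw [h3, norm_smul, CStarRing.norm_star_mul_self, ← CStarRing.norm_self_mul_star, star_mul, hs',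
    hz.star_eq, show z * (s : B) * (s * z) = z * (s * s) * z by simp only [mul_assoc], hss',
    Real.norm_of_nonneg hδ.le]
  calc δ * ‖z * (a : B) * z‖ ≤ δ * 1 := by gcongr
    _ < ε := by simp only [δ]; linarith

end Comparison

/-! ### Matrix entries in the regular representations -/

section Entries

open scoped Classical

variable {X : Type*} [Groupoid X]

lemma eq_of_idArrow_eq {u x : X} {γ η : SourceFiber u}
    (h : idArrow x = Arrow.mk (inv η.2 ≫ γ.2)) : γ = η := by
  obtain ⟨y, γ⟩ := γ
  obtain ⟨z, η⟩ := η
  obtain rfl : x = z := congrArg (fun γ : Arrow X => γ.left) h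
  obtain rfl : x = y := congrArg (fun γ : Arrow X => γ.right) h
  have h1 : 𝟙 x = inv η ≫ γ := Arrow.mk_injective _ _ h
  rw [IsIso.eq_inv_comp, Category.comp_id] at h1
  rw [h1]

/-- Since `γ η⁻¹` is a unit only for `γ = η`, functions on the unit space act as diagonal operators,
with the value at the range of `γ` on the diagonal. -/
lemma extendUnits_regKernel (f : X → ℂ) {u : X} (γ η : SourceFiber u) :
    extendUnits f (Arrow.mk (inv η.2 ≫ γ.2)) = if γ = η then f γ.1 else 0 := by
  split_ifs with h
  · subst h
    have : Arrow.mk (inv γ.2 ≫ γ.2) = idArrow γ.1 := by simp [idArrow]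
    rw [this, extendUnits_idArrow]
  · refine extendUnits_of_notMem f ?_
    rintro ⟨x, hx⟩
    exact h (eq_of_idArrow_eq hx)

variable [TopologicalSpace X] [TopologicalSpace (Arrow X)] [IsEtaleGroupoid X]
  [T2Space (Arrow X)] [LocallyCompactSpace (Arrow X)]

/-- The component of an element of the reduced C*-algebra at the regular representation on
`ℓ²(G u)`. -/
def component (u : X) (T : ReducedCStarAlgebra X) : ℓ²(SourceFiber u, ℂ) →L[ℂ] ℓ²(SourceFiber u, ℂ) :=
  (show RegOps X from T.1).1 u

lemma component_mul (u : X) (S T : ReducedCStarAlgebra X) :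
    component u (S * T) = component u S * component u T := rfl

lemma component_star (u : X) (T : ReducedCStarAlgebra X) :
    component u (star T) = star (component u T) := rfl

lemma component_ofC0 (u : X) (f : C₀(X, ℂ)) :
    component u (ofC0 f) = regRepAt (extendUnits f) (iNorm_extendUnits_ne_top f) u := rfl

lemma norm_component_le (u : X) (T : ReducedCStarAlgebra X) : ‖component u T‖ ≤ ‖T‖ :=
  lp.norm_apply_le_norm ENNReal.top_ne_zero
    (show lp (fun u : X => ℓ²(SourceFiber u, ℂ) →L[ℂ] ℓ²(SourceFiber u, ℂ)) ∞ from T.1) u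

/-- The `(γ, η)` entry of an element of the reduced C*-algebra in the regular representation
on `ℓ²(G u)`. -/
def entry {u : X} (γ η : SourceFiber u) : ReducedCStarAlgebra X →L[ℂ] ℂ :=
  LinearMap.mkContinuous
    { toFun := fun T => component u T (lp.single 2 η 1) γ
      map_add' := fun _ _ => rfl
      map_smul' := fun _ _ => rfl } 1 fun T => by
    rw [one_mul]
    refine (lp.norm_apply_le_norm (by norm_num) (component u T (lp.single 2 η 1)) γ).trans ?_
    refine ((component u T).le_opNorm _).trans ?_
    rw [lp.norm_single (by norm_num), norm_one, mul_one]
    exact norm_component_le u T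

lemma entry_apply {u : X} (γ η : SourceFiber u) (T : ReducedCStarAlgebra X) :
    entry γ η T = component u T (lp.single 2 η 1) γ := rfl

lemma norm_entry_le {u : X} (γ η : SourceFiber u) (T : ReducedCStarAlgebra X) :
    ‖entry γ η T‖ ≤ ‖T‖ := by
  simpa using (entry γ η).le_of_opNorm_le (LinearMap.mkContinuous_norm_le _ zero_le_one _) T

lemma ext_entry {S T : ReducedCStarAlgebra X}
    (h : ∀ (u : X) (γ η : SourceFiber u), entry γ η S = entry γ η T) : S = T :=
  Subtype.ext (RegOps.ext fun u => ext_matrix fun γ η => h u γ η)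

lemma entry_ofCc (F : C_c(Arrow X, ℂ)) {u : X} (γ η : SourceFiber u) :
    entry γ η (ofCc F) = F (Arrow.mk (inv η.2 ≫ γ.2)) :=
  regRepAt_single (iNorm_ne_top F.continuous F.hasCompactSupport) u γ η

lemma entry_ofC0 (f : C₀(X, ℂ)) {u : X} (γ η : SourceFiber u) :
    entry γ η (ofC0 f) = if γ = η then f γ.1 else 0 :=
  (regRepAt_single (iNorm_extendUnits_ne_top f) u γ η).trans (extendUnits_regKernel f γ η)

lemma entry_ofC0_mul (f : C₀(X, ℂ)) (T : ReducedCStarAlgebra X) {u : X} (γ η : SourceFiber u) :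
    entry γ η (ofC0 f * T) = f γ.1 * entry γ η T := by
  rw [entry_apply, component_mul, mul_apply_eq_comp, component_ofC0, regRepAt_apply,
    tsum_eq_single γ]
  · rw [extendUnits_regKernel, if_pos rfl]
    rfl
  · intro ζ hζ
    rw [extendUnits_regKernel, if_neg hζ.symm, zero_mul]

lemma entry_star (T : ReducedCStarAlgebra X) {u : X} (γ η : SourceFiber u) :
    entry γ η (star T) = star (entry η γ T) := by
  rw [entry_apply, component_star, ContinuousLinearMap.star_eq_adjoint]
  have h1 := lp.inner_single_left (𝕜 := ℂ) (G := fun _ : SourceFiber u => ℂ) γ 1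
    ((component u T).adjoint (lp.single 2 η 1))
  rw [ContinuousLinearMap.adjoint_inner_right, lp.inner_single_right] at h1
  simpa [entry_apply] using h1.symm

lemma ofC0_star (f : C₀(X, ℂ)) : star (ofC0 f) = ofC0 (star f) := by
  refine ext_entry fun u γ η => ?_
  rw [entry_star, entry_ofC0, entry_ofC0]
  by_cases h : γ = η
  · subst h
    simp
  · simp [h, Ne.symm h]

lemma entry_mul_ofC0 (f : C₀(X, ℂ)) (T : ReducedCStarAlgebra X) {u : X} (γ η : SourceFiber u) :
    entry γ η (T * ofC0 f) = entry γ η T * f η.1 := by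
  have h : T * ofC0 f = star (ofC0 (star f) * star T) := by
    rw [star_mul, star_star, ofC0_star, star_star]
  rw [h, entry_star, entry_ofC0_mul, entry_star]
  simp [mul_comm]

lemma ofC0_mul (f g : C₀(X, ℂ)) : ofC0 (f * g) = ofC0 f * ofC0 g := by
  refine ext_entry fun u γ η => ?_
  rw [entry_ofC0_mul, entry_ofC0, entry_ofC0]
  split_ifs <;> simp

lemma ofC0_add (f g : C₀(X, ℂ)) : ofC0 (f + g) = ofC0 f + ofC0 g := by
  refine ext_entry fun u γ η => ?_
  rw [map_add, entry_ofC0, entry_ofC0, entry_ofC0]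
  split_ifs <;> simp

lemma ofC0_sub (f g : C₀(X, ℂ)) : ofC0 (f - g) = ofC0 f - ofC0 g := by
  refine ext_entry fun u γ η => ?_
  rw [map_sub, entry_ofC0, entry_ofC0, entry_ofC0]
  split_ifs <;> simp

lemma ofC0_smul (c : ℂ) (f : C₀(X, ℂ)) : ofC0 (c • f) = c • ofC0 f := by
  refine ext_entry fun u γ η => ?_
  rw [map_smul, entry_ofC0, entry_ofC0]
  split_ifs <;> simp

lemma ofC0_injective : Function.Injective (ofC0 : C₀(X, ℂ) → ReducedCStarAlgebra X) := by
  intro f g h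
  ext x
  have := congrArg (entry (⟨x, 𝟙 x⟩ : SourceFiber x) ⟨x, 𝟙 x⟩) h
  simpa [entry_ofC0] using this

lemma ofC0_zero : ofC0 (0 : C₀(X, ℂ)) = 0 := by
  simpa using ofC0_smul (0 : ℂ) (0 : C₀(X, ℂ))

lemma norm_ofC0_le {f : C₀(X, ℂ)} {C : ℝ} (hC : 0 ≤ C) (h : ∀ x, ‖f x‖ ≤ C) : ‖ofC0 f‖ ≤ C :=
  (norm_regRep_le _ (iNorm_extendUnits_ne_top f)).trans (ENNReal.toReal_le_of_le_ofReal hC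
    (iNorm_le_ofReal_of_units (norm_extendUnits_le hC h) fun _ h => extendUnits_of_notMem _ h))

lemma ofC0_nonneg {f : C₀(X, ℂ)} (hf : ∀ x, 0 ≤ f x) : 0 ≤ ofC0 f := by
  let g : C₀(X, ℂ) :=
    { toFun := fun x => (√(f x).re : ℂ)
      continuous_toFun := by fun_prop
      zero_at_infty' := by
        have h : Tendsto (fun z : ℂ => ((√z.re : ℝ) : ℂ)) (𝓝 0) (𝓝 ((√(0 : ℂ).re : ℝ) : ℂ)) :=
          Continuous.tendsto (by fun_prop) 0
        simp only [Complex.zero_re, Real.sqrt_zero, Complex.ofReal_zero] at h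
        exact h.comp f.zero_at_infty' }
  have hg : f = star g * g := by
    ext x
    obtain ⟨h1, h2⟩ := Complex.nonneg_iff.1 (hf x)
    change f x = star ((√(f x).re : ℝ) : ℂ) * ((√(f x).re : ℝ) : ℂ)
    rw [Complex.star_def, Complex.conj_ofReal, ← Complex.ofReal_mul, Real.mul_self_sqrt h1]
    exact Complex.ext rfl h2.symm
  rw [hg, ofC0_mul, ← ofC0_star]
  exact star_mul_self_nonneg _

lemma ofC0_mono {f g : C₀(X, ℂ)} (h : ∀ x, f x ≤ g x) : ofC0 f ≤ ofC0 g := by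
  rw [← sub_nonneg, ← ofC0_sub]
  exact ofC0_nonneg fun x => by simpa using h x

lemma denseRange_ofCc : DenseRange (ofCc : C_c(Arrow X, ℂ) → ReducedCStarAlgebra X) := by
  intro T
  refine (closure_subtype (X := RegOps X) (p := (· ∈ (regImage X).topologicalClosure))).2 ?_
  refine closure_mono ?_ T.2
  rintro _ ⟨F, rfl⟩
  exact ⟨ofCc F, ⟨F, rfl⟩, rfl⟩

/-- The entries only depend on `γ η⁻¹`. -/
lemma entry_eq_entry_id (T : ReducedCStarAlgebra X) {u : X} (γ η : SourceFiber u) :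
    entry γ η T = entry (⟨γ.1, inv η.2 ≫ γ.2⟩ : SourceFiber η.1) ⟨η.1, 𝟙 η.1⟩ T := by
  -- On `C_c(G)` both entries are the value at `γ η⁻¹`, and both sides are continuous in `T`.
  refine denseRange_ofCc.induction_on T (isClosed_eq (by fun_prop) (by fun_prop)) fun F => ?_
  rw [entry_ofCc, entry_ofCc]
  simp

/-- The diagonal of a positive element of the reduced C*-algebra is nonnegative, and it is
nonzero if the element is. -/
lemma exists_diagonal_pos {b : ReducedCStarAlgebra X} (hb : 0 ≤ b) (hb0 : b ≠ 0) :
    ∃ (u : X) (r : ℝ), 0 < r ∧ entry (⟨u, 𝟙 u⟩ : SourceFiber u) ⟨u, 𝟙 u⟩ b = r := by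
  obtain ⟨c, rfl⟩ := CStarAlgebra.nonneg_iff_eq_star_mul_self.1 hb
  have hdiag : ∀ u : X, entry (⟨u, 𝟙 u⟩ : SourceFiber u) ⟨u, 𝟙 u⟩ (star c * c) =
      ((‖component u c (lp.single 2 ⟨u, 𝟙 u⟩ 1)‖ ^ 2 : ℝ) : ℂ) := by
    intro u
    rw [entry_apply, component_mul, component_star, mul_apply_eq_comp,
      ContinuousLinearMap.star_eq_adjoint]
    have h1 := lp.inner_single_left (𝕜 := ℂ) (G := fun _ : SourceFiber u => ℂ) ⟨u, 𝟙 u⟩ 1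
      ((component u c).adjoint (component u c (lp.single 2 ⟨u, 𝟙 u⟩ 1)))
    rw [ContinuousLinearMap.adjoint_inner_right, inner_self_eq_norm_sq_to_K] at h1
    simpa using h1.symm
  by_contra! hcon
  have hzero : ∀ u : X, component u c (lp.single 2 ⟨u, 𝟙 u⟩ 1) = 0 := by
    intro u
    by_contra hne
    exact hcon u _ (by positivity) (hdiag u)
  -- By translation invariance every entry of `c` occurs in a column indexed by a unit, and those
  -- columns all vanish.
  have hc : c = 0 := by
    refine ext_entry fun u γ η => ?_
    rw [entry_eq_entry_id, entry_apply, hzero, map_zero]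
    rfl
  exact hb0 (by simp [hc])

end Entries

/-! ### Minimality: spreading a function on the unit space -/

section Cones

lemma exists_bump {Y : Type*} [TopologicalSpace Y] [T2Space Y] [LocallyCompactSpace Y] {K U : Set Y}
    (hK : IsCompact K) (hU : IsOpen U) (hKU : K ⊆ U) :
    ∃ f : C(Y, ℝ), HasCompactSupport f ∧ (∀ y ∈ K, f y = 1) ∧ (∀ y, 0 ≤ f y) ∧ (∀ y, f y ≤ 1) ∧
      ∀ y ∉ U, f y = 0 := by
  obtain ⟨f, h1, h0, hc, hf⟩ := exists_continuous_one_zero_of_isCompact hK hU.isClosed_compl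
    (Set.disjoint_compl_right_iff_subset.2 hKU)
  exact ⟨f, hc, h1, fun y => (hf y).1, fun y => (hf y).2, fun y hy => h0 hy⟩

/-- A compactly supported real function as a complex function vanishing at infinity. -/
def realC0 {Y : Type*} [TopologicalSpace Y] (f : C(Y, ℝ)) (hf : HasCompactSupport f) : C₀(Y, ℂ) where
  toFun y := f y
  continuous_toFun := by fun_prop
  zero_at_infty' :=
    (hf.comp_left (g := fun r : ℝ => (r : ℂ)) Complex.ofReal_zero).is_zero_at_infty

@[simp]
lemma realC0_apply {Y : Type*} [TopologicalSpace Y] (f : C(Y, ℝ)) (hf : HasCompactSupport f)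
    (y : Y) : realC0 f hf y = f y := rfl

variable {X : Type*} [Groupoid X] [TopologicalSpace X] [TopologicalSpace (Arrow X)]
  [IsEtaleGroupoid X]

lemma locallyCompactSpace_units [LocallyCompactSpace (Arrow X)] : LocallyCompactSpace X :=
  (isOpenEmbedding_idArrow (X := X)).locallyCompactSpace

variable [T2Space (Arrow X)] [LocallyCompactSpace (Arrow X)]

lemma ofCc_star (H : C_c(Arrow X, ℂ)) :
    ofCc ⟨⟨starFun H, continuous_star.comp (H.continuous.comp continuous_invArrow)⟩,
      hasCompactSupport_starFun H.hasCompactSupport⟩ = star (ofCc H) :=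
  Subtype.ext (regRep_star _ _)

lemma ofCc_conv (F H : C_c(Arrow X, ℂ)) :
    ofCc ⟨⟨convFun F H, continuous_convFun F.continuous F.hasCompactSupport H.continuous⟩,
      hasCompactSupport_convFun F.hasCompactSupport H.hasCompactSupport⟩ = ofCc F * ofCc H :=
  Subtype.ext (regRep_conv _ _ _)

lemma ofC0_mul_ofCc (f : C₀(X, ℂ)) (F F' : C_c(Arrow X, ℂ)) (h : ∀ γ, F' γ = f γ.right * F γ) :
    ofC0 f * ofCc F = ofCc F' :=
  ext_entry fun u γ η => by rw [entry_ofC0_mul, entry_ofCc, entry_ofCc, h]; rfl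

/-- Functions in `C_c(G)` supported in the unit space. -/
lemma exists_ofC0_eq_ofCc (K : C_c(Arrow X, ℂ))
    (hK : ∀ γ ∉ Set.range (idArrow : X → Arrow X), K γ = 0) :
    ∃ ψ : C₀(X, ℂ), (∀ y, ψ y = K (idArrow y)) ∧ ofC0 ψ = ofCc K := by
  have hcl : IsClosedEmbedding (idArrow : X → Arrow X) :=
    ⟨isOpenEmbedding_idArrow.isEmbedding, isClosed_range_idArrow⟩
  let ψ : C₀(X, ℂ) :=
    { toFun := fun y => K (idArrow y)
      continuous_toFun := K.continuous.comp hcl.continuous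
      zero_at_infty' := (K.hasCompactSupport.comp_isClosedEmbedding hcl).is_zero_at_infty }
  have hext : extendUnits ψ = K := by
    funext γ
    by_cases hγ : γ ∈ Set.range (idArrow : X → Arrow X)
    · obtain ⟨y, rfl⟩ := hγ
      exact extendUnits_idArrow _ _
    · rw [extendUnits_of_notMem _ hγ, hK γ hγ]
  refine ⟨ψ, fun _ => rfl, ext_entry fun u γ η => ?_⟩
  rw [entry_ofC0, ← extendUnits_regKernel, hext, entry_ofCc]

/-- In a minimal groupoid a nonzero positive function on the unit space can be moved, by conjugating
with a function supported in a bisection, to a function that is large at a given point. -/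
lemma exists_conj_eq_ofC0 (hmin : IsMinimalGroupoid X) {g : C₀(X, ℂ)} (hg : ∀ x, 0 ≤ g x)
    (hg0 : g ≠ 0) (x : X) (M : ℝ) :
    ∃ (w : ReducedCStarAlgebra X) (ψ : C₀(X, ℂ)), (∀ y, 0 ≤ ψ y) ∧ M < (ψ x).re ∧
      ofC0 ψ = star w * ofC0 g * w := by
  obtain ⟨y₀, hy₀⟩ : ∃ y, g y ≠ 0 := by
    by_contra! h
    exact hg0 (ZeroAtInftyContinuousMap.ext h)
  -- Density of the orbit of `x` gives an arrow `γ` from `x` to a point where `g` does not vanish.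
  obtain ⟨y, hy, γ, rfl, rfl⟩ := (hmin x).inter_open_nonempty {y | g y ≠ 0}
    (isOpen_ne_fun g.continuous continuous_const) ⟨y₀, hy₀⟩
  obtain ⟨e₁, h₁, he₁⟩ := IsEtaleGroupoid.isLocalHomeomorph_source (X := X) γ
  obtain ⟨e₂, h₂, he₂⟩ := isLocalHomeomorph_range (X := X) γ
  obtain ⟨b, hbc, hb1, -, -, hb0⟩ := exists_bump (isCompact_singleton (x := γ))
    (e₁.open_source.inter e₂.open_source) (Set.singleton_subset_iff.2 ⟨h₁, h₂⟩)
  have hr : 0 < (g γ.right).re := by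
    rcases Complex.nonneg_iff.1 (hg γ.right) with ⟨h1, h2⟩
    exact lt_of_le_of_ne h1 fun h => hy (Complex.ext h.symm h2.symm)
  -- Scaled so that the conjugated function takes the value `|M| + 1` at `x`.
  set t : ℝ := √((|M| + 1) / (g γ.right).re)
  have ht : t * t * (g γ.right).re = |M| + 1 := by
    rw [Real.mul_self_sqrt (by positivity)]
    field_simp
  let H : C_c(Arrow X, ℂ) := ⟨⟨fun α => ((t * b α : ℝ) : ℂ), by fun_prop⟩,
    hbc.comp_left (g := fun r : ℝ => ((t * r : ℝ) : ℂ)) (by simp)⟩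
  have hH : ∀ α, H α = ((t * b α : ℝ) : ℂ) := fun _ => rfl
  have hHU : ∀ α, H α ≠ 0 → α ∈ e₁.source ∧ α ∈ e₂.source := fun α hα => by
    by_contra h
    exact hα (by rw [hH, hb0 α h]; simp)
  let L : C_c(Arrow X, ℂ) := ⟨⟨fun α => g α.right * H α,
    (g.continuous.comp continuous_range).mul H.continuous⟩, H.hasCompactSupport.mul_left⟩
  have hL : ofC0 g * ofCc H = ofCc L := ofC0_mul_ofCc g H L fun _ => rfl
  let H' : C_c(Arrow X, ℂ) :=
    ⟨⟨starFun H, continuous_star.comp (H.continuous.comp continuous_invArrow)⟩,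
      hasCompactSupport_starFun H.hasCompactSupport⟩
  let K : C_c(Arrow X, ℂ) :=
    ⟨⟨convFun H' L, continuous_convFun H'.continuous H'.hasCompactSupport L.continuous⟩,
      hasCompactSupport_convFun H'.hasCompactSupport L.hasCompactSupport⟩
  have hK : ofCc K = star (ofCc H) * ofC0 g * ofCc H := by
    rw [mul_assoc, hL, ← ofCc_star, ← ofCc_conv]
  have hKα : ∀ α : Arrow X, K α = ∑' η : RangeFiber α.right, star (H (Arrow.mk (inv η.2))) *
      (g η.1 * H (Arrow.mk (α.hom ≫ inv η.2))) := fun _ => rfl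
  have hKid : ∀ y : X, K (idArrow y) = ∑' η : RangeFiber y,
      g η.1 * (star (H (Arrow.mk (inv η.2))) * H (Arrow.mk (inv η.2))) := by
    intro y
    refine (hKα _).trans (tsum_congr fun η => ?_)
    have : Arrow.mk ((idArrow y).hom ≫ inv η.2) = Arrow.mk (inv η.2) :=
      congrArg Arrow.mk (Category.id_comp (inv η.2))
    rw [this]
    exact mul_left_comm _ _ _
  -- A nonzero term needs `η⁻¹` and `η⁻¹ α` both in the bisection. They have the same range, so they
  -- agree and `α` is a unit.
  have hunits : ∀ α ∉ Set.range (idArrow : X → Arrow X), K α = 0 := by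
    intro α hα
    rw [hKα]
    refine (tsum_congr fun η => ?_).trans tsum_zero
    by_contra hne
    have h1 := hHU _ (star_ne_zero.1 (left_ne_zero_of_mul hne))
    have h2 := hHU _ (right_ne_zero_of_mul (right_ne_zero_of_mul hne))
    have h3 : Arrow.mk (inv η.2) = Arrow.mk (α.hom ≫ inv η.2) := by
      refine e₂.injOn h1.2 h2.2 ?_
      rw [← he₂]
      rfl
    apply hα
    obtain ⟨y, z, α, rfl⟩ := Arrow.mk_surjective α
    obtain rfl : z = y := congrArg (fun γ : Arrow X => γ.left) h3
    have h4 : inv η.2 = α ≫ inv η.2 := Arrow.mk_injective _ _ h3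
    rw [IsIso.eq_comp_inv, IsIso.inv_hom_id] at h4
    exact ⟨z, congrArg Arrow.mk h4⟩
  obtain ⟨ψ, hψ, hψK⟩ := exists_ofC0_eq_ofCc K hunits
  refine ⟨ofCc H, ψ, fun y => ?_, ?_, hψK.trans hK⟩
  · rw [hψ, hKid]
    exact tsum_nonneg fun η => mul_nonneg (hg _) (star_mul_self_nonneg _)
  -- Injectivity of the source map on the bisection leaves only the term of `γ` itself.
  · rw [hψ, hKid, tsum_eq_single (⟨γ.right, inv γ.hom⟩ : RangeFiber γ.left)]
    · have h1 : Arrow.mk (inv (inv γ.hom)) = γ := by simp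
      have h2 : H γ = (t : ℂ) := by rw [hH, hb1 γ rfl, mul_one]
      simp only [h1, h2, Complex.star_def, Complex.conj_ofReal, ← Complex.ofReal_mul,
        Complex.re_mul_ofReal]
      rw [mul_comm, ht]
      linarith [le_abs_self M]
    · intro η hη
      by_contra hne
      have h1 := hHU _ (right_ne_zero_of_mul (right_ne_zero_of_mul hne))
      have h3 : Arrow.mk (inv η.2) = γ := by
        refine e₁.injOn h1.1 h₁ ?_
        rw [← he₁]
        rfl
      refine hη (rangeFiber_mk_injective γ.left ?_)
      have h4 : Arrow.mk η.2 = invArrow (Arrow.mk (inv η.2)) := by simp [invArrow]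
      exact h4.trans (congrArg invArrow h3)

variable {S : Set (ReducedCStarAlgebra X)}

/-- In a minimal groupoid, a closed cone that is closed under conjugation and contains all the
conjugates of a nonzero positive function on the unit space contains all positive elements. -/
lemma star_mul_self_mem (hmin : IsMinimalGroupoid X) (hcl : IsClosed S)
    (hadd : ∀ a ∈ S, ∀ b ∈ S, a + b ∈ S) (hconj : ∀ a ∈ S, ∀ w, star w * a * w ∈ S)
    {g : C₀(X, ℂ)} (hg : ∀ x, 0 ≤ g x) (hg0 : g ≠ 0) (hgS : ∀ w, star w * ofC0 g * w ∈ S)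
    (T : ReducedCStarAlgebra X) : star T * T ∈ S := by
  have hLC : LocallyCompactSpace X := locallyCompactSpace_units
  have hT2 : T2Space X := t2Space_units
  have hbelow : ∀ a b, Below a b → b ∈ S → a ∈ S := fun a b hab hb => by
    refine closure_minimal ?_ hcl hab
    rintro _ ⟨w, rfl⟩
    exact hconj b hb w
  have hφ : ∀ φ : C₀(X, ℂ), (∀ y, 0 ≤ φ y) → HasCompactSupport φ → ofC0 φ ∈ S := by
    intro φ hφ hc
    -- Each point of the support has a neighbourhood where one conjugate of `g` exceeds `φ`. By
    -- compactness a finite sum of conjugates dominates `φ`.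
    have key : ∃ ψ : C₀(X, ℂ), ofC0 ψ ∈ S ∧ (∀ y, 0 ≤ ψ y) ∧
        ∀ y ∈ tsupport φ, (φ y).re ≤ (ψ y).re := by
      refine IsCompact.induction_on (p := fun K => ∃ ψ : C₀(X, ℂ), ofC0 ψ ∈ S ∧ (∀ y, 0 ≤ ψ y) ∧
        ∀ y ∈ K, (φ y).re ≤ (ψ y).re) hc ?_ ?_ ?_ ?_
      · refine ⟨0, ?_, fun _ => le_rfl, fun y hy => hy.elim⟩
        simpa [ofC0_zero] using hgS 0
      · rintro K K' hKK' ⟨ψ, h1, h2, h3⟩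
        exact ⟨ψ, h1, h2, fun y hy => h3 y (hKK' hy)⟩
      · rintro K K' ⟨ψ, h1, h2, h3⟩ ⟨ψ', h1', h2', h3'⟩
        refine ⟨ψ + ψ', ?_, fun y => add_nonneg (h2 y) (h2' y), fun y hy => ?_⟩
        · rw [ofC0_add]
          exact hadd _ h1 _ h1'
        · have p1 := (Complex.nonneg_iff.1 (h2 y)).1
          have p2 := (Complex.nonneg_iff.1 (h2' y)).1
          change _ ≤ (ψ y).re + (ψ' y).re
          rcases hy with hy | hy
          · linarith [h3 y hy]
          · linarith [h3' y hy]
      · intro x _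
        obtain ⟨w, ψ, h1, h2, h3⟩ := exists_conj_eq_ofC0 hmin hg hg0 x (φ x).re
        refine ⟨{y | (φ y).re < (ψ y).re}, mem_nhdsWithin_of_mem_nhds (IsOpen.mem_nhds
          (isOpen_lt (by fun_prop) (by fun_prop)) h2), ψ, h3 ▸ hgS w, h1, fun y hy => le_of_lt hy⟩
    obtain ⟨ψ, h1, h2, h3⟩ := key
    refine hbelow _ _ (below_of_le (ofC0_nonneg hφ) (ofC0_mono fun y => ?_)) h1
    by_cases hy : y ∈ tsupport φ
    · exact Complex.le_def.2 ⟨h3 y hy, (Complex.nonneg_iff.1 (hφ y)).2.symm.trans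
        (Complex.nonneg_iff.1 (h2 y)).2⟩
    · rw [image_eq_zero_of_notMem_tsupport hy]
      exact h2 y
  refine denseRange_ofCc.induction_on (p := fun T => star T * T ∈ S) T
    (hcl.preimage (by fun_prop)) fun F => ?_
  -- With `b = 1` on the range of the support, `F⋆ F = F⋆ b F` is a conjugate of a compactly
  -- supported function.
  obtain ⟨b, hbc, hb1, hb0, -, -⟩ := exists_bump (F.hasCompactSupport.isCompact.image
    (continuous_range (X := X))) isOpen_univ (Set.subset_univ _)
  have h1 : ofC0 (realC0 b hbc) * ofCc F = ofCc F := by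
    refine ofC0_mul_ofCc _ _ _ fun γ => ?_
    by_cases hγ : γ ∈ tsupport F
    · simp [hb1 γ.right ⟨γ, hγ, rfl⟩]
    · simp [image_eq_zero_of_notMem_tsupport hγ]
  have h2 : star (ofCc F) * ofCc F = star (ofCc F) * ofC0 (realC0 b hbc) * ofCc F := by
    rw [mul_assoc, h1]
  rw [h2]
  refine hconj _ (hφ _ (fun y => ?_) ?_) _
  · simpa using hb0 y
  · exact hbc.comp_left (g := fun r : ℝ => (r : ℂ)) Complex.ofReal_zero

end Cones

/-! ### Topological principality: cutting down to the unit space -/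

section Cutting

variable {X : Type*} [Groupoid X] [TopologicalSpace X] [TopologicalSpace (Arrow X)]
  [IsEtaleGroupoid X] [T2Space (Arrow X)]

/-- A unit with trivial isotropy has a neighbourhood over which a compactly supported function
lives only on units. -/
lemma exists_nhds_isotropy_free (F : C_c(Arrow X, ℂ)) {v : X} (hv : ∀ γ : v ⟶ v, γ = 𝟙 v) :
    ∃ W : Set X, IsOpen W ∧ v ∈ W ∧ ∀ α : Arrow X, α.left ∈ W → α.right ∈ W →
      α ∉ Set.range (idArrow : X → Arrow X) → F α = 0 := by
  have hT2 : T2Space X := t2Space_units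
  have hK : IsCompact (tsupport F ∩ (Set.range (idArrow : X → Arrow X))ᶜ) :=
    F.hasCompactSupport.isCompact.inter_right isOpenEmbedding_idArrow.isOpen_range.isClosed_compl
  -- The support off the units is compact, as the units are open. Its image under source and range
  -- is thus closed, and trivial isotropy keeps `(v, v)` out of it.
  have hC : IsClosed ((fun α : Arrow X => (α.left, α.right)) ''
      (tsupport F ∩ (Set.range (idArrow : X → Arrow X))ᶜ)) :=
    (hK.image (continuous_source.prodMk continuous_range)).isClosed
  have hvC : (v, v) ∈ ((fun α : Arrow X => (α.left, α.right)) ''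
      (tsupport F ∩ (Set.range (idArrow : X → Arrow X))ᶜ))ᶜ := by
    rintro ⟨α, ⟨-, hα⟩, h⟩
    obtain ⟨y, z, α, rfl⟩ := Arrow.mk_surjective α
    obtain rfl : y = v := congrArg Prod.fst h
    obtain rfl : z = y := congrArg Prod.snd h
    exact hα ⟨z, congrArg Arrow.mk (hv α).symm⟩
  obtain ⟨W₁, W₂, h1, hv1, h2, hv2, hW⟩ :=
    mem_nhds_prod_iff'.1 (hC.isOpen_compl.mem_nhds hvC)
  refine ⟨W₁ ∩ W₂, h1.inter h2, ⟨hv1, hv2⟩, fun α hl hr hα => ?_⟩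
  by_contra hne
  exact hW (Set.mk_mem_prod hl.1 hr.2) ⟨α, ⟨subset_tsupport _ hne, hα⟩, rfl⟩

variable [LocallyCompactSpace (Arrow X)]

lemma entry_id_ofCc (F : C_c(Arrow X, ℂ)) (u : X) :
    entry (⟨u, 𝟙 u⟩ : SourceFiber u) ⟨u, 𝟙 u⟩ (ofCc F) = F (idArrow u) := by
  rw [entry_ofCc]
  simp [idArrow]

/-- In the reduced C*-algebra of a topologically principal groupoid, every nonzero positive element
dominates a nonzero positive function on the unit space. -/
lemma exists_ofC0_below (htp : IsTopologicallyPrincipal X) {b : ReducedCStarAlgebra X}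
    (hb : 0 ≤ b) (hb0 : b ≠ 0) :
    ∃ k : C₀(X, ℂ), (∀ x, 0 ≤ k x) ∧ k ≠ 0 ∧ Below (ofC0 k) b := by
  have hLC : LocallyCompactSpace X := locallyCompactSpace_units
  have hT2 : T2Space X := t2Space_units
  obtain ⟨u, r, hr, hur⟩ := exists_diagonal_pos hb hb0
  -- Only `2 * ε < r` matters: one `ε` pays for replacing `b` by `F`, another for replacing `F` by
  -- the constant `r` near `v`.
  set ε := r / 8
  have hε : 0 < ε := by positivity
  obtain ⟨F, hF⟩ := denseRange_ofCc.exists_dist_lt b hε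
  rw [dist_eq_norm] at hF
  have hV : IsOpen {y : X | ‖F (idArrow y) - r‖ < ε} :=
    isOpen_lt ((F.continuous.comp isOpenEmbedding_idArrow.continuous).sub continuous_const).norm
      continuous_const
  have huV : ‖F (idArrow u) - r‖ < ε := by
    rw [← entry_id_ofCc, ← hur, ← map_sub, ← neg_sub, map_neg, norm_neg]
    exact (norm_entry_le _ _ _).trans_lt hF
  obtain ⟨v, hvV, hv⟩ := htp.inter_open_nonempty _ hV ⟨u, huV⟩
  obtain ⟨W, hW, hvW, hWF⟩ := exists_nhds_isotropy_free F hv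
  obtain ⟨K, hK, hvK, hKW⟩ := exists_compact_subset (hW.inter hV) ⟨hvW, hvV⟩
  obtain ⟨f, hfc, hf1, hf0, hfle, hfW⟩ := exists_bump hK (hW.inter hV) hKW
  obtain ⟨k, hkc, hk1, hk0, -, hkK⟩ := exists_bump (isCompact_singleton (x := v)) isOpen_interior
    (Set.singleton_subset_iff.2 hvK)
  set p := ofC0 (realC0 f hfc)
  set q := ofC0 (realC0 k hkc)
  have hp : star p = p := by
    rw [ofC0_star]
    congr 1
    ext x
    simp
  have hq : star q = q := by
    rw [ofC0_star]
    congr 1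
    ext x
    simp
  -- The second bump lives where the first equals 1, so an estimate on `p * b * p` can be cut down
  -- by `q` without leaving factors of `p`.
  have hqp : q * p = q := by
    rw [← ofC0_mul]
    congr 1
    ext x
    by_cases hx : x ∈ interior K
    · simp [hf1 x (interior_subset hx)]
    · simp [hkK x hx]
  have hpq : p * q = q := by
    rw [← hp, ← hq, ← star_mul, hqp]
  have hpn : ‖p‖ ≤ 1 := norm_ofC0_le zero_le_one fun x => by
    simpa [abs_of_nonneg (hf0 x)] using hfle x
  let D : C_c(Arrow X, ℂ) := ⟨⟨fun α => (f α.right : ℂ) * F α * f α.left,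
    ((Complex.continuous_ofReal.comp (f.continuous.comp continuous_range)).mul F.continuous).mul
      (Complex.continuous_ofReal.comp (f.continuous.comp continuous_source))⟩,
    F.hasCompactSupport.mul_left.mul_right⟩
  have hD : ∀ α, D α = f α.right * F α * f α.left := fun _ => rfl
  have hpF : p * ofCc F * p = ofCc D := by
    refine ext_entry fun w γ η => ?_
    rw [entry_mul_ofC0, entry_ofC0_mul, entry_ofCc, entry_ofCc]
    rfl
  obtain ⟨ψ, hψ, hψD⟩ := exists_ofC0_eq_ofCc D fun α hα => by
    rw [hD]
    by_cases hl : α.left ∈ W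
    · by_cases hr : α.right ∈ W
      · rw [hWF α hl hr hα]
        simp
      · simp [hfW α.right fun h => hr h.1]
    · simp [hfW α.left fun h => hl h.1]
  -- Inside `W` only the diagonal of `F` remains, so this is a supremum estimate for functions on
  -- the unit space.
  have hdiff : ‖p * ofCc F * p - (r : ℂ) • (p * p)‖ ≤ ε := by
    rw [hpF, ← hψD, ← ofC0_mul, ← ofC0_smul, ← ofC0_sub]
    refine norm_ofC0_le hε.le fun y => ?_
    have h1 : (ψ - (r : ℂ) • (realC0 f hfc * realC0 f hfc)) y =
        (f y * f y : ℝ) * (F (idArrow y) - r) := by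
      change ψ y - r * (f y * f y) = _
      rw [hψ, hD]
      change (f y : ℂ) * F (idArrow y) * f y - _ = _
      push_cast
      ring
    rw [h1, norm_mul]
    by_cases hy : y ∈ W ∩ {y : X | ‖F (idArrow y) - r‖ < ε}
    · have h2 : ‖((f y * f y : ℝ) : ℂ)‖ ≤ 1 := by
        rw [Complex.norm_real, Real.norm_of_nonneg (mul_self_nonneg _)]
        nlinarith [hf0 y, hfle y]
      calc _ ≤ 1 * ‖F (idArrow y) - r‖ := by gcongr
        _ ≤ ε := by rw [one_mul]; exact hy.2.le
    · simp [hfW y hy, hε.le]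
  set R := p * b * p - (r : ℂ) • (p * p)
  have hR : ‖R‖ ≤ 2 * ε := by
    have h1 : R = p * (b - ofCc F) * p + (p * ofCc F * p - (r : ℂ) • (p * p)) := by
      simp only [R, mul_sub, sub_mul]
      abel
    have h2 : ‖p * (b - ofCc F) * p‖ ≤ ε := by
      calc _ ≤ ‖p‖ * ‖b - ofCc F‖ * ‖p‖ := norm_mul₃_le
        _ ≤ 1 * ε * 1 := by gcongr
        _ = ε := by ring
    rw [h1]
    linarith [norm_add_le (p * (b - ofCc F) * p) (p * ofCc F * p - (r : ℂ) • (p * p))]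
  have hRsa : IsSelfAdjoint (-R) := by
    rw [IsSelfAdjoint]
    simp only [R, star_neg, star_sub, star_smul, star_mul, hp, hb.isSelfAdjoint.star_eq,
      Complex.star_def, Complex.conj_ofReal, mul_assoc]
  have hqR : star q * (-R) * q = (r : ℂ) • (q * q) - q * b * q := by
    have h1 : q * (p * b * p) * q = q * b * q := by
      rw [← mul_assoc, ← mul_assoc, hqp, mul_assoc _ p q, hpq]
    have h2 : q * (p * p) * q = q * q := by
      rw [← mul_assoc, hqp, hqp]
    rw [hq]
    simp only [R, neg_sub, mul_sub, sub_mul, mul_smul_comm, smul_mul_assoc, h1, h2]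
  -- Conjugation by `q` turns the norm bound into an order bound, `q b q ≥ (r - 2ε) q²`, whose right
  -- side is a nonzero function.
  have hle := CStarAlgebra.star_left_conjugate_le_norm_smul (a := q) (b := -R) hRsa
  rw [hqR, hq, norm_neg] at hle
  have hqq : 0 ≤ q * q := by
    have := star_mul_self_nonneg q
    rwa [hq] at this
  have hle2 : (r : ℂ) • (q * q) - q * b * q ≤ (2 * ε) • (q * q) :=
    hle.trans (smul_le_smul_of_nonneg_right hR hqq)
  let s : ℝ := r - 2 * ε
  have hs : 0 < s := by simp only [s, ε]; linarith
  have hknn : ∀ x, 0 ≤ ((s : ℂ) • (realC0 k hkc * realC0 k hkc)) x := fun x => by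
    change (0 : ℂ) ≤ s * (k x * k x)
    exact_mod_cast mul_nonneg hs.le (mul_self_nonneg (k x))
  refine ⟨(s : ℂ) • (realC0 k hkc * realC0 k hkc), hknn, fun h => ?_, ?_⟩
  · have h1 : (s : ℂ) * (k v * k v) = 0 := DFunLike.congr_fun h v
    rw [hk1 v rfl] at h1
    simp [hs.ne'] at h1
  · refine (below_of_le (ofC0_nonneg hknn) ?_ : Below _ (q * b * q)).trans ?_
    · rw [ofC0_smul, ofC0_mul, Complex.coe_smul, sub_smul, sub_le_comm]
      simpa only [Complex.coe_smul] using hle2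
    · have := below_conj b q
      rwa [hq] at this

end Cutting

/-! ### One-dimensional corners and characters -/

section Characters

variable {A : Type*} [NonUnitalCStarAlgebra A] [PartialOrder A] [StarOrderedRing A]

/-- If the corner of a projection `e` is one-dimensional and `e` dominates every positive element,
then the compression to the corner is a character. -/
lemma corner_mul {e : A} (he : star e = e) (hee : e * e = e) (he0 : e ≠ 0) (j : A →L[ℂ] ℂ)
    (hj : ∀ T, e * T * e = j T • e) (hbelow : ∀ a : A, 0 ≤ a → Below a e) (S T : A) :
    j (S * T) = j S * j T := by
  have hinj : ∀ {c d : ℂ}, c • e = d • e → c = d := fun h => smul_left_injective ℂ he0 h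
  have hmid : ∀ S T, j (S * e * T) = j S * j T := fun S T => hinj <| by
    calc j (S * e * T) • e = e * (S * (e * e) * T) * e := by rw [hee, hj]
      _ = (e * S * e) * (e * T * e) := by simp only [mul_assoc]
      _ = (j S * j T) • e := by
        rw [hj, hj, smul_mul_assoc, mul_smul_comm, hee, smul_smul]
  have hright : ∀ T, T * e = e * T * e := by
    intro T
    -- The off-diagonal part `(1 - e) T e`; once it vanishes, compression by `e` is multiplicative.
    set t := T * e - e * T * e
    suffices ht : t = 0 from sub_eq_zero.1 ht
    have h1 : t * e = t := by
      simp only [t, sub_mul, mul_assoc, hee]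
    have h2 : e * t = 0 := by
      simp only [t, mul_sub, ← mul_assoc, hee, sub_self]
    have h3 : star t * e = 0 := by rw [← he, ← star_mul, h2, star_zero]
    have h4 : e * star t = star t := by rw [← he, ← star_mul, h1]
    have hm : star t * t = j (star t * t) • e := by
      rw [← hj, ← mul_assoc, h4, mul_assoc, h1]
    set m := j (star t * t)
    have hje : j e = 1 := hinj (by rw [← hj, hee, hee, one_smul])
    have hjt : j t = 0 := hinj (by rw [← hj, h2, zero_mul, zero_smul])
    -- If `t ≠ 0`, then `e + t t⋆` should be too large to lie below the rank-one `e`; the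
    -- determinant below detects this.
    have hmem := hbelow (e + t * star t) (add_nonneg
      (by simpa [he, hee] using star_mul_self_nonneg e) (mul_star_self_nonneg t))
    -- For `z = x⋆ e x` all four terms factor by `hmid` and the determinant vanishes. At `z = e + t
    -- t⋆` it equals `m ^ 2`, where `star t * t = m • e`.
    have key := closure_minimal
      (t := {z : A | j z * j (star t * z * t) - j (z * t) * j (star t * z) = 0})
      (by
        rintro _ ⟨x, rfl⟩
        have e1 : star t * (star x * e * x) * t = (star t * star x) * e * (x * t) := by
          simp only [mul_assoc]
        have e2 : star x * e * x * t = star x * e * (x * t) := by simp only [mul_assoc]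
        have e3 : star t * (star x * e * x) = (star t * star x) * e * x := by simp only [mul_assoc]
        simp only [Set.mem_ofPred_eq]
        rw [e1, e2, e3, hmid, hmid, hmid, hmid]
        ring) (isClosed_eq (by fun_prop) continuous_const) hmem
    have f1 : j (e + t * star t) = 1 := by
      rw [map_add, hje, add_eq_left]
      exact hinj (by rw [← hj, ← mul_assoc, h2, zero_mul, zero_mul, zero_smul])
    have f2 : star t * (e + t * star t) * t = (m * m) • e := by
      rw [mul_add, h3, zero_add, ← mul_assoc, hm, mul_assoc, hm, smul_mul_assoc, mul_smul_comm, hee,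
        smul_smul]
    have f3 : j ((e + t * star t) * t) = 0 := by
      rw [add_mul, h2, zero_add, mul_assoc, hm, mul_smul_comm, h1, map_smul, hjt, smul_zero]
    have hm0 : m = 0 := by
      simpa [f1, f2, f3, hje] using key
    rw [hm0, zero_smul] at hm
    exact (CStarRing.star_mul_self_eq_zero_iff t).1 hm
  refine hinj ?_
  rw [← hj, ← mul_assoc, mul_assoc (e * S) T e, hright T, ← mul_assoc, ← mul_assoc, hj S,
    smul_mul_assoc, smul_mul_assoc, hj, smul_smul]

end Characters

/-! ### Infinite functions and pure infiniteness -/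

section PureInfiniteness

variable {X : Type*} [Groupoid X] [TopologicalSpace X] [TopologicalSpace (Arrow X)]
  [IsEtaleGroupoid X] [T2Space (Arrow X)] [LocallyCompactSpace (Arrow X)]

/-- Infiniteness supplies one nonzero absorbed element. A function below it seeds the cone argument,
which enlarges the absorbed set to all positive elements. -/
lemma mem_absorbed_of_isInfinite (hmin : IsMinimalGroupoid X) (htp : IsTopologicallyPrincipal X)
    {f : C₀(X, ℂ)} (hf : IsInfinite (ofC0 f)) {a : ReducedCStarAlgebra X} (ha : 0 ≤ a) :
    a ∈ absorbed (ofC0 f) := by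
  obtain ⟨hf0, d, hd, hd0, hfd⟩ := hf
  rw [cuntzBelow_directSum hf0.isSelfAdjoint] at hfd
  obtain ⟨g, hg, hg0, hgd⟩ := exists_ofC0_below htp hd hd0
  obtain ⟨c, rfl⟩ := CStarAlgebra.nonneg_iff_eq_star_mul_self.1 ha
  refine star_mul_self_mem hmin (isClosed_absorbed _)
    (fun a ha b hb => absorbed_add hf0.isSelfAdjoint ha hb) (fun a ha w => absorbed_conj ha w)
    hg hg0 (fun w => ?_) c
  refine closure_minimal ?_ (isClosed_absorbed _) (hgd.conj w)
  rintro _ ⟨x, rfl⟩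
  exact absorbed_conj hfd x

lemma below_of_isInfinite (hmin : IsMinimalGroupoid X) (htp : IsTopologicallyPrincipal X)
    (hinf : ∀ f : C₀(X, ℂ), (∀ x, 0 ≤ f x) → f ≠ 0 → IsInfinite (ofC0 f))
    {a b : ReducedCStarAlgebra X} (ha : 0 ≤ a) (hb : 0 ≤ b) (hb0 : b ≠ 0) : Below a b := by
  obtain ⟨h, hh, hh0, hhb⟩ := exists_ofC0_below htp hb hb0
  exact (below_of_mem_absorbed (mem_absorbed_of_isInfinite hmin htp (hinf h hh hh0) ha)).trans hhb

/-- A character kills a self-absorbing function, hence every positive element below it; positive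
elements span the algebra. -/
lemma isEmpty_characterSpace (hmin : IsMinimalGroupoid X) (htp : IsTopologicallyPrincipal X)
    (hinf : ∀ f : C₀(X, ℂ), (∀ x, 0 ≤ f x) → f ≠ 0 → IsInfinite (ofC0 f)) :
    IsEmpty (WeakDual.characterSpace ℂ (ReducedCStarAlgebra X)) := by
  refine ⟨fun ⟨χ, hχ0, hχ⟩ => hχ0 ?_⟩
  have hc : Continuous χ := map_continuous χ
  have key : ∀ a : ReducedCStarAlgebra X, 0 ≤ a → χ a = 0 := by
    intro a ha
    by_cases ha0 : a = 0
    · rw [ha0, map_zero]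
    obtain ⟨h, hh, hh0, -⟩ := exists_ofC0_below htp ha ha0
    have hh' := ofC0_nonneg hh
    have hχh : χ (ofC0 h) = 0 := map_eq_zero_of_self_mem_absorbed hh'.isSelfAdjoint
      (mem_absorbed_of_isInfinite hmin htp (hinf h hh hh0) hh') hc hχ (map_zero χ)
    refine closure_minimal (t := {z | χ z = 0}) ?_ (isClosed_eq hc continuous_const)
      (below_of_mem_absorbed (mem_absorbed_of_isInfinite hmin htp (hinf h hh hh0) ha))
    rintro _ ⟨x, rfl⟩
    simp [hχ, hχh]
  refine DFunLike.ext _ _ fun a => ?_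
  have ha : a ∈ Submodule.span ℂ {a : ReducedCStarAlgebra X | 0 ≤ a} := by
    rw [CStarAlgebra.span_nonneg]
    trivial
  induction ha using Submodule.span_induction with
  | mem x hx => exact key x hx
  | zero => exact map_zero χ
  | add x y _ _ hx hy => rw [map_add, hx, hy]; exact (map_add (0 : WeakDual ℂ _) x y).symm
  | smul c x _ hx => rw [map_smul, hx]; exact (map_smul (0 : WeakDual ℂ _) c x).symm

lemma mem_closure_span_of_below {A : Type*} [NonUnitalCStarAlgebra A] {a b : A} (h : Below a b) :
    a ∈ closure (Submodule.span ℂ {z : A | ∃ x y : A, z = x * b * y} : Set A) := by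
  refine closure_mono ?_ h
  rintro _ ⟨x, rfl⟩
  exact Submodule.subset_span ⟨star x, x, rfl⟩

lemma isPurelyInfinite_of_isInfinite (hmin : IsMinimalGroupoid X)
    (htp : IsTopologicallyPrincipal X)
    (hinf : ∀ f : C₀(X, ℂ), (∀ x, 0 ≤ f x) → f ≠ 0 → IsInfinite (ofC0 f)) :
    IsPurelyInfinite (ReducedCStarAlgebra X) := by
  refine ⟨isEmpty_characterSpace hmin htp hinf, fun a b ha hb => ?_⟩
  rw [cuntzBelow_oneByOne]
  refine ⟨mem_closure_span_of_below, fun h => ?_⟩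
  -- Membership in the ideal only matters for `b = 0`; a nonzero `b` dominates everything positive.
  by_cases hb0 : b = 0
  · subst hb0
    have h0 : {z : ReducedCStarAlgebra X | ∃ x y, z = x * 0 * y} = {0} := by
      ext z
      simp
    rw [h0, Submodule.span_zero_singleton, Submodule.bot_coe, closure_singleton] at h
    rw [Set.mem_singleton_iff.1 h]
    exact subset_closure ⟨0, by simp⟩
  · exact below_of_isInfinite hmin htp hinf ha hb hb0

/-- In a minimal groupoid with purely infinite reduced C*-algebra, the nonzero positive functions
on the unit space dominate every positive element. -/
lemma below_ofC0_of_isPurelyInfinite (hmin : IsMinimalGroupoid X)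
    (hpi : IsPurelyInfinite (ReducedCStarAlgebra X)) {g : C₀(X, ℂ)} (hg : ∀ x, 0 ≤ g x)
    (hg0 : g ≠ 0) {a : ReducedCStarAlgebra X} (ha : 0 ≤ a) : Below a (ofC0 g) := by
  rw [← cuntzBelow_oneByOne, hpi.2 a _ ha (ofC0_nonneg hg)]
  obtain ⟨c, rfl⟩ := CStarAlgebra.nonneg_iff_eq_star_mul_self.1 ha
  set I := Submodule.span ℂ {z : ReducedCStarAlgebra X | ∃ x y, z = x * ofC0 g * y}
  -- The closed ideal generated by `g` is a closed conjugation-invariant cone, so it contains every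
  -- positive element.
  refine star_mul_self_mem hmin isClosed_closure
    (fun a ha b hb => I.topologicalClosure.add_mem ha hb) (fun a ha w => ?_) hg hg0
    (fun w => mem_closure_span_of_below (below_conj _ w)) c
  refine map_mem_closure (f := fun z => star w * z * w) (by fun_prop) ha fun z hz => ?_
  induction hz using Submodule.span_induction with
  | mem x hx =>
    obtain ⟨y, z, rfl⟩ := hx
    exact Submodule.subset_span ⟨star w * y, z * w, by simp only [mul_assoc]⟩
  | zero => simp
  | add x y _ _ hx hy =>
    simp only [mul_add, add_mul]
    exact I.add_mem hx hy
  | smul c x _ hx =>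
    simp only [mul_smul_comm, smul_mul_assoc]
    exact I.smul_mem c hx

/-- Disjoint bumps `P` and `Q` at the two points give orthogonal pieces `P f P` and `Q f Q`. All of
`f` lies below the first piece, so the second is absorbed. -/
lemma isInfinite_of_two_points (hmin : IsMinimalGroupoid X)
    (hpi : IsPurelyInfinite (ReducedCStarAlgebra X)) {f : C₀(X, ℂ)} (hf : ∀ x, 0 ≤ f x)
    {x y : X} (hxy : x ≠ y) (hx : f x ≠ 0) (hy : f y ≠ 0) : IsInfinite (ofC0 f) := by
  have hLC : LocallyCompactSpace X := locallyCompactSpace_units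
  have hT2 : T2Space X := t2Space_units
  obtain ⟨U, V, hU, hV, hxU, hyV, hUV⟩ := t2_separation hxy
  obtain ⟨p, hpc, hp1, hp0, -, hpU⟩ := exists_bump (isCompact_singleton (x := x)) hU
    (Set.singleton_subset_iff.2 hxU)
  obtain ⟨q, hqc, hq1, hq0, -, hqV⟩ := exists_bump (isCompact_singleton (x := y)) hV
    (Set.singleton_subset_iff.2 hyV)
  set P := realC0 p hpc
  set Q := realC0 q hqc
  have hP : star P = P := by ext x; simp [P]
  have hQ : star Q = Q := by ext x; simp [Q]
  have hPnn : ∀ z, 0 ≤ (P * f * P) z := fun z =>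
    mul_nonneg (mul_nonneg (by simpa [P] using hp0 z) (hf z)) (by simpa [P] using hp0 z)
  have hQnn : ∀ z, 0 ≤ (Q * f * Q) z := fun z =>
    mul_nonneg (mul_nonneg (by simpa [Q] using hq0 z) (hf z)) (by simpa [Q] using hq0 z)
  have hPne : P * f * P ≠ 0 := fun h => hx (by
    simpa [P, hp1 x rfl] using DFunLike.congr_fun h x)
  have hQne : Q * f * Q ≠ 0 := fun h => hy (by
    simpa [Q, hq1 y rfl] using DFunLike.congr_fun h y)
  have hPQ : P * f * Q = 0 := by
    ext z
    by_cases hz : z ∈ U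
    · simp [Q, hqV z (Set.disjoint_left.1 hUV hz)]
    · simp [P, hpU z hz]
  have hfnn := ofC0_nonneg hf
  refine ⟨hfnn, ofC0 (Q * f * Q), ofC0_nonneg hQnn, fun h => hQne ?_, ?_⟩
  · exact ofC0_injective (h.trans ofC0_zero.symm)
  · rw [cuntzBelow_directSum hfnn.isSelfAdjoint]
    refine map_mem_closure (f := fun z => (z, (0 : ReducedCStarAlgebra X), ofC0 (Q * f * Q)))
      (by fun_prop) (below_ofC0_of_isPurelyInfinite hmin hpi hPnn hPne hfnn) ?_
    rintro _ ⟨w, rfl⟩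
    -- Here `star w * (P f P) * w` approximates `f`, and the off-diagonal entry vanishes exactly
    -- because `P f Q = 0`.
    refine ⟨(ofC0 P * w, ofC0 Q), ?_⟩
    have h1 : star (ofC0 P * w) * ofC0 f * (ofC0 P * w) = star w * ofC0 (P * f * P) * w := by
      rw [star_mul, ofC0_star, hP, ofC0_mul, ofC0_mul]
      simp only [mul_assoc]
    have h2 : star (ofC0 P * w) * ofC0 f * ofC0 Q = 0 := by
      rw [star_mul, ofC0_star, hP, mul_assoc, mul_assoc, ← ofC0_mul, ← ofC0_mul, ← mul_assoc P, hPQ,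
        ofC0_zero, mul_zero]
    have h3 : star (ofC0 Q) * ofC0 f * ofC0 Q = ofC0 (Q * f * Q) := by
      rw [ofC0_star, hQ, ofC0_mul, ofC0_mul]
    simp only [h1, h2, h3]

/-- If the reduced C*-algebra is purely infinite, then no positive function on the unit space is
supported at one point. -/
lemma exists_ne_of_isPurelyInfinite (hmin : IsMinimalGroupoid X)
    (htp : IsTopologicallyPrincipal X) (hpi : IsPurelyInfinite (ReducedCStarAlgebra X))
    {f : C₀(X, ℂ)} {x : X} (hx : f x ≠ 0) : ∃ y, x ≠ y ∧ f y ≠ 0 := by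
  by_contra! hcon
  have hopen : {y | f y ≠ 0} = {x} := by
    ext y
    refine ⟨fun hy => ?_, ?_⟩
    · by_contra hne
      exact hy (hcon y (Ne.symm hne))
    · rintro rfl
      exact hx
  -- The point is isolated, so density of the units with trivial isotropy forces it to be one of
  -- them.
  obtain ⟨x', hx', htriv⟩ := htp.inter_open_nonempty {y | f y ≠ 0}
    (isOpen_ne_fun f.continuous continuous_const) ⟨x, hx⟩
  rw [hopen] at hx'
  obtain rfl : x' = x := hx'
  set δ : C₀(X, ℂ) := (f x')⁻¹ • f
  have hδ1 : δ x' = 1 := inv_mul_cancel₀ hx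
  have hδ0 : ∀ y, y ≠ x' → δ y = 0 := fun y hy => by
    simp [δ, hcon y hy.symm]
  have hδnn : ∀ y, 0 ≤ δ y := fun y => by
    by_cases hy : y = x'
    · rw [hy, hδ1]
      exact zero_le_one
    · rw [hδ0 y hy]
  have hδne : δ ≠ 0 := fun h => by
    rw [h] at hδ1
    exact zero_ne_one hδ1
  have hδδ : δ * δ = δ := by
    ext y
    by_cases hy : y = x'
    · simp [hy, hδ1]
    · simp [hδ0 y hy]
  set e := ofC0 δ
  set j := entry (⟨x', 𝟙 x'⟩ : SourceFiber x') ⟨x', 𝟙 x'⟩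
  -- Only entries between arrows ending at `x'` survive, and trivial isotropy makes two such arrows
  -- with the same source equal.
  have hj : ∀ T, e * T * e = j T • e := by
    intro T
    refine ext_entry fun u γ η => ?_
    rw [entry_mul_ofC0, entry_ofC0_mul, map_smul, entry_ofC0, smul_eq_mul]
    obtain ⟨y, γ⟩ := γ
    obtain ⟨z, η⟩ := η
    by_cases hy : y = x'
    · subst hy
      by_cases hz : z = y
      · subst hz
        have h1 : γ = η := by
          have := htriv (inv η ≫ γ)
          rwa [IsIso.inv_comp_eq, Category.comp_id] at this
        subst h1
        rw [entry_eq_entry_id, hδ1, if_pos rfl]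
        simp [j]
      · rw [if_neg fun h => hz (congrArg Sigma.fst h).symm]
        simp [hδ0 z hz]
    · simp [hδ0 y hy]
  have hmul := corner_mul (ofC0_nonneg hδnn).isSelfAdjoint.star_eq
    (by rw [← ofC0_mul, hδδ]) (fun h => hδne (ofC0_injective (h.trans ofC0_zero.symm))) j hj
    fun a ha => below_ofC0_of_isPurelyInfinite hmin hpi hδnn hδne ha
  refine hpi.1.false ⟨StrongDual.toWeakDual j, fun h => ?_, hmul⟩
  have h1 : j e = 0 := DFunLike.congr_fun h e
  rw [entry_ofC0, if_pos rfl, hδ1] at h1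
  exact one_ne_zero h1

end PureInfiniteness

end GroupoidCStar

end

open GroupoidCStar in
theorem theorem3p3 {X : Type*} [Groupoid X] [TopologicalSpace X] [TopologicalSpace (Arrow X)]
    [LocallyCompactSpace (Arrow X)] [T2Space (Arrow X)] [IsEtaleGroupoid X]
    (hmin : IsMinimalGroupoid X) (htp : IsTopologicallyPrincipal X) :
    IsPurelyInfinite (ReducedCStarAlgebra X) ↔
      ∀ f : C₀(X, ℂ), (∀ x, 0 ≤ f x) → f ≠ 0 → IsInfinite (ofC0 f) := by
  refine ⟨fun hpi f hf hf0 => ?_, isPurelyInfinite_of_isInfinite hmin htp⟩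
  obtain ⟨x, hx⟩ : ∃ x, f x ≠ 0 := by
    by_contra! h
    exact hf0 (ZeroAtInftyContinuousMap.ext h)
  obtain ⟨y, hxy, hy⟩ := exists_ne_of_isPurelyInfinite hmin htp hpi hx
  exact isInfinite_of_two_points hmin hpi hf hxy hx hy
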